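/- Consider positive solutions of $$\frac{d^{3}\varphi}{d\zeta^{3}}=\frac{1}{\varphi^{3}} \qquad (1)$$ on open intervals; a solution is called maximal if it cannot be extended to a positive solution on a larger open interval. Here $f\sim g$ means that $f/g\to1$. (i) For every $K>0$ there is a solution $\varphi$ of (1), defined on all of $\mathbb{R}$, with $\varphi(\zeta)\sim-K\zeta$ as $\zeta\to-\infty$. It is unique up to translation in $\zeta$: every solution of (1) defined near $-\infty$ with this asymptotic behaviour coincides, on its interval, with a translate $\varphi(\cdot+c)$. The translate can be chosen in exactly one way so that $$\varphi(\zeta)=-K\zeta-\frac{\log(-\zeta)}{2K^{3}}+o(1)\quad\text{as }\zeta\to-\infty,$$ and every solution of (1) defined near $-\infty$ that satisfies this condition coincides with that $\varphi$ on its interval. Moreover $\varphi(\zeta)\sim\Gamma\zeta^{2}$ as $\zeta\to+\infty$ for some $\Gamma>0$. (ii) For every $K>0$ there are $\zeta^{*}\in\mathbb{R}$ and a maximal solution $\varphi$ of (1), defined on $(\zeta^{*},\infty)$, with $\varphi(\zeta)\sim K\zeta$ as $\zeta\to+\infty$ and $\varphi(\zeta)\to0$ as $\zeta\to(\zeta^{*})^{+}$.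 It is unique up to translation in $\zeta$ among the solutions of (1) defined near $+\infty$ with $\varphi(\zeta)\sim K\zeta$, and the translate can be chosen in exactly one way so that $$\varphi(\zeta)=K\zeta+\frac{\log\zeta}{2K^{3}}+o(1)\quad\text{as }\zeta\to+\infty,$$ which then determines the solution uniquely (again, any solution of (1) defined near $+\infty$ with this behaviour coincides with it on its interval). (iii) For every $c\in\mathbb{R}$ the function $\varphi(\zeta)=(64/15)^{1/4}(\zeta-c)^{3/4}$ is a maximal solution of (1), on $(c,\infty)$. (iv) Every other maximal solution of (1), that is, every one that is not asymptotic to $-K\zeta$ as $\zeta\to-\infty$ for any $K>0$, is not asymptotic to $K\zeta$ as $\zeta\to+\infty$ for any $K>0$, and is not one of the solutions in (iii), is defined near $+\infty$ and satisfies $\varphi(\zeta)\sim\Gamma\zeta^{2}$ as $\zeta\to+\infty$ for some $\Gamma>0$. Backward, either it is defined exactly on $(\zeta^{*},\infty)$ for some finite $\zeta^{*}$ and $\varphi(\zeta)\to0$ as $\zeta\to(\zeta^{*})^{+}$, or it is defined on all of $\mathbb{R}$ and $\varphi(\zeta)\sim\tilde\Gamma\zeta^{2}$ as $\zeta\to-\infty$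 for some $\tilde\Gamma>0$. -/

import Mathlib

open Filter Topology Asymptotics Set

/-- `φ` is a positive solution of `φ''' = 1 / φ ^ 3` on the nonempty open interval `I`
(bounded or not). -/
structure IsSolutionOn (φ : ℝ → ℝ) (I : Set ℝ) : Prop where
  isOpen : IsOpen I
  ordConnected : I.OrdConnected
  nonempty : I.Nonempty
  contDiffOn : ContDiffOn ℝ 3 φ I
  pos : ∀ ζ ∈ I, 0 < φ ζ
  ode : ∀ ζ ∈ I, iteratedDeriv 3 φ ζ = 1 / (φ ζ) ^ 3

/-- A positive solution on `I` that is not the restriction of a positive solution on a strictly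
larger open interval. -/
structure IsMaximalSolution (φ : ℝ → ℝ) (I : Set ℝ) : Prop where
  isSolutionOn : IsSolutionOn φ I
  maximal : ∀ (ψ : ℝ → ℝ) (J : Set ℝ), IsSolutionOn ψ J → I ⊆ J → EqOn ψ φ I → J = I

/-- The solution `(64 / 15) ^ (1 / 4) * (ζ - c) ^ (3 / 4)`, considered for `c < ζ`. -/
noncomputable def powerSolution (c ζ : ℝ) : ℝ :=
  (64 / 15 : ℝ) ^ (1 / 4 : ℝ) * (ζ - c) ^ (3 / 4 : ℝ)

/-- `φ` is defined near `-∞` and `φ(ζ) ~ -K ζ` as `ζ → -∞`. -/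
def LinearAtBot (φ : ℝ → ℝ) (I : Set ℝ) (K : ℝ) : Prop :=
  ¬ BddBelow I ∧ φ ~[atBot] fun ζ => -K * ζ

/-- `φ` is defined near `+∞` and `φ(ζ) ~ K ζ` as `ζ → +∞`. -/
def LinearAtTop (φ : ℝ → ℝ) (I : Set ℝ) (K : ℝ) : Prop :=
  ¬ BddAbove I ∧ φ ~[atTop] fun ζ => K * ζ

/-- `φ` is defined near `-∞` and `φ(ζ) ~ Γ ζ ^ 2` as `ζ → -∞`, for some `Γ > 0`. -/
def ParabolicAtBot (φ : ℝ → ℝ) (I : Set ℝ) : Prop :=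
  ¬ BddBelow I ∧ ∃ Γ : ℝ, 0 < Γ ∧ φ ~[atBot] fun ζ => Γ * ζ ^ 2

/-- `φ` is defined near `+∞` and `φ(ζ) ~ Γ ζ ^ 2` as `ζ → +∞`, for some `Γ > 0`. -/
def ParabolicAtTop (φ : ℝ → ℝ) (I : Set ℝ) : Prop :=
  ¬ BddAbove I ∧ ∃ Γ : ℝ, 0 < Γ ∧ φ ~[atTop] fun ζ => Γ * ζ ^ 2

/-! Write the equation as a system `u' = v`, `v' = w`, `w' = σ / u ^ 3` with `σ = 1`. Reflecting
time gives the same system with `σ = -1`, so behaviour at `-∞` or at a left endpoint is studied at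
`+∞` or at a right endpoint. Since `u > 0`, `w` is monotone, and everything rests on this.

Endpoints: forward in time a solution cannot approach `0` at a finite time, because the blow-up of
`1 / u ^ 3` would make `v` positive (`exists_pos_le_nhdsLT`). Hence maximal solutions reach `+∞`.
Backward, `u` has a limit at a finite endpoint, and maximality forces it to be `0` (`eq_Ioi`).

Infinity: `w` tends either to some `l > 0`, giving `u ~ l t ^ 2 / 2`, or to `0`, and then `v` tends
to some `K`, with `K ≥ 0` for `σ = 1` and `K > 0` for `σ = -1` (`tendsto_alternative`,
`tendsto_alternative_neg`).

For `K > 0`, integrating `w'` three times from infinity yields the logarithmic expansion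
(`exists_tendsto_sub_log`) and shows that its constant term determines the solution
(`eventuallyEq_of_tendsto_sub`). A contraction argument gives existence (`exists_traj_linear`). A
translation by `c` changes the constant by `K c`, so it can be normalized in exactly one way.

For `K = 0` and `σ = 1`, a monotone quantity for the difference of two solutions shows that the left
endpoint determines the solution (`eqOn_of_sublinear`), so it is the explicit power solution.
Finally, on the whole line `w → 0` at `+∞` is impossible (`not_tendsto_w_zero`): `w` would be
squeezed between a limit `≥ 0` at `-∞` and `0`. This makes the solutions of (i) parabolic at `+∞`
and gives those of (ii) a finite left endpoint. -/

/-- `(u, v, w)` is a solution on `I` of the first order system `u' = v`, `v' = w`,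
`w' = σ / u ^ 3` with `u > 0`. -/
structure Traj (σ : ℝ) (u v w : ℝ → ℝ) (I : Set ℝ) : Prop where
  pos : ∀ t ∈ I, 0 < u t
  du : ∀ t ∈ I, HasDerivAt u (v t) t
  dv : ∀ t ∈ I, HasDerivAt v (w t) t
  dw : ∀ t ∈ I, HasDerivAt w (σ / u t ^ 3) t

/-! ### The first order system: symmetries, smoothness, uniqueness. -/

namespace Traj

variable {σ : ℝ} {u v w : ℝ → ℝ} {I : Set ℝ}

theorem mono {J : Set ℝ} (h : Traj σ u v w I) (hJ : J ⊆ I) : Traj σ u v w J :=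
  ⟨fun t ht => h.pos t (hJ ht), fun t ht => h.du t (hJ ht), fun t ht => h.dv t (hJ ht),
    fun t ht => h.dw t (hJ ht)⟩

theorem congr_of_eventuallyEq {u' v' w' : ℝ → ℝ}
    (h : ∀ t ∈ I, ∃ p q r : ℝ → ℝ, ∃ J : Set ℝ, t ∈ J ∧ Traj σ p q r J ∧
      u' =ᶠ[𝓝 t] p ∧ v' =ᶠ[𝓝 t] q ∧ w' =ᶠ[𝓝 t] r) : Traj σ u' v' w' I := by
  refine ⟨fun t ht => ?_, fun t ht => ?_, fun t ht => ?_, fun t ht => ?_⟩ <;>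
  obtain ⟨p, q, r, J, htJ, hT, e1, e2, e3⟩ := h t ht
  · rw [e1.eq_of_nhds]; exact hT.pos t htJ
  · rw [e2.eq_of_nhds]; exact (hT.du t htJ).congr_of_eventuallyEq e1
  · rw [e3.eq_of_nhds]; exact (hT.dv t htJ).congr_of_eventuallyEq e2
  · rw [e1.eq_of_nhds]; exact (hT.dw t htJ).congr_of_eventuallyEq e3

/-- Odd derivatives change sign under reflection, hence `-v` and `-σ`. This is the only bridge
between the two ends of the line. -/
theorem comp_neg (h : Traj σ u v w I) :
    Traj (-σ) (fun t => u (-t)) (fun t => -v (-t)) (fun t => w (-t)) (-I) := by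
  refine ⟨fun t ht => h.pos _ ht, fun t ht => ?_, fun t ht => ?_, fun t ht => ?_⟩
  · exact ((h.du (-t) ht).comp t (hasDerivAt_neg t)).congr_deriv (by simp)
  · exact ((h.dv (-t) ht).comp t (hasDerivAt_neg t)).neg.congr_deriv (by simp)
  · exact ((h.dw (-t) ht).comp t (hasDerivAt_neg t)).congr_deriv (by simp [neg_div])

theorem comp_add_const (h : Traj σ u v w I) (c : ℝ) :
    Traj σ (fun t => u (t + c)) (fun t => v (t + c)) (fun t => w (t + c)) {t | t + c ∈ I} :=
  ⟨fun _ ht => h.pos _ ht, fun t ht => (h.du (t + c) ht).comp_add_const t c,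
    fun t ht => (h.dv (t + c) ht).comp_add_const t c,
    fun t ht => (h.dw (t + c) ht).comp_add_const t c⟩

theorem iteratedDeriv_three (hI : IsOpen I) (h : Traj σ u v w I) {t : ℝ} (ht : t ∈ I) :
    iteratedDeriv 3 u t = σ / u t ^ 3 := by
  have e1 : ∀ s ∈ I, deriv u =ᶠ[𝓝 s] v := fun s hs => by
    filter_upwards [hI.mem_nhds hs] with r hr using (h.du r hr).deriv
  have e2 : ∀ s ∈ I, deriv (deriv u) =ᶠ[𝓝 s] w := fun s hs => by
    filter_upwards [hI.mem_nhds hs] with r hr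
    rw [(e1 r hr).deriv_eq, (h.dv r hr).deriv]
  rw [iteratedDeriv_succ, iteratedDeriv_succ, iteratedDeriv_one, (e2 t ht).deriv_eq,
    (h.dw t ht).deriv]

theorem contDiffOn (hI : IsOpen I) (h : Traj σ u v w I) : ContDiffOn ℝ 3 u I := by
  have hu0 : ContinuousOn u I := fun t ht => (h.du t ht).continuousAt.continuousWithinAt
  have hw : ContDiffOn ℝ 1 w I := by
    rw [show (1 : WithTop ℕ∞) = 0 + 1 from rfl, contDiffOn_succ_iff_deriv_of_isOpen hI]
    refine ⟨fun t ht => (h.dw t ht).differentiableAt.differentiableWithinAt, by simp, ?_⟩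
    rw [contDiffOn_zero]
    refine (continuousOn_const.div (hu0.pow 3) fun t ht => ?_ : ContinuousOn
      (fun t => σ / u t ^ 3) I).congr fun t ht => (h.dw t ht).deriv
    have := h.pos t ht
    positivity
  have hv : ContDiffOn ℝ 2 v I := by
    rw [show (2 : WithTop ℕ∞) = 1 + 1 from rfl, contDiffOn_succ_iff_deriv_of_isOpen hI]
    exact ⟨fun t ht => (h.dv t ht).differentiableAt.differentiableWithinAt, by simp,
      hw.congr fun t ht => (h.dv t ht).deriv⟩
  rw [show (3 : WithTop ℕ∞) = 2 + 1 from rfl, contDiffOn_succ_iff_deriv_of_isOpen hI]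
  exact ⟨fun t ht => (h.du t ht).differentiableAt.differentiableWithinAt, by simp,
    hv.congr fun t ht => (h.du t ht).deriv⟩

theorem isSolutionOn (h : Traj 1 u v w I) (hI : IsOpen I) (hc : I.OrdConnected)
    (hn : I.Nonempty) : IsSolutionOn u I :=
  ⟨hI, hc, hn, h.contDiffOn hI, h.pos, fun _ ht => h.iteratedDeriv_three hI ht⟩

end Traj

theorem IsSolutionOn.traj {φ : ℝ → ℝ} {I : Set ℝ} (h : IsSolutionOn φ I) :
    Traj 1 φ (deriv φ) (deriv (deriv φ)) I := by
  have h3 := h.contDiffOn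
  have hI := h.isOpen
  rw [show (3 : WithTop ℕ∞) = 2 + 1 from rfl, contDiffOn_succ_iff_deriv_of_isOpen hI] at h3
  have h2 := h3.2.2
  rw [show (2 : WithTop ℕ∞) = 1 + 1 from rfl, contDiffOn_succ_iff_deriv_of_isOpen hI] at h2
  have h1 := h2.2.2
  rw [show (1 : WithTop ℕ∞) = 0 + 1 from rfl, contDiffOn_succ_iff_deriv_of_isOpen hI] at h1
  refine ⟨h.pos, fun t ht => ((h3.1 t ht).differentiableAt (hI.mem_nhds ht)).hasDerivAt,
    fun t ht => ((h2.1 t ht).differentiableAt (hI.mem_nhds ht)).hasDerivAt, fun t ht => ?_⟩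
  rw [← h.ode t ht, iteratedDeriv_succ, iteratedDeriv_succ, iteratedDeriv_one]
  exact ((h1.1 t ht).differentiableAt (hI.mem_nhds ht)).hasDerivAt

/-- The vector field of the first order system. -/
noncomputable def trajField (σ : ℝ) (x : ℝ × ℝ × ℝ) : ℝ × ℝ × ℝ := (x.2.1, x.2.2, σ / x.1 ^ 3)

theorem contDiffAt_trajField (σ : ℝ) {x : ℝ × ℝ × ℝ} (hx : x.1 ≠ 0) :
    ContDiffAt ℝ 1 (trajField σ) x := by
  unfold trajField
  refine (contDiffAt_fst.comp x contDiffAt_snd).prodMk ((contDiffAt_snd.comp x contDiffAt_snd).prodMk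
    (contDiffAt_const.div (contDiffAt_fst.pow 3) (pow_ne_zero 3 hx)))

namespace Traj

variable {σ : ℝ} {u v w : ℝ → ℝ} {I : Set ℝ}

theorem hasDerivAt_prodMk (h : Traj σ u v w I) {t : ℝ} (ht : t ∈ I) :
    HasDerivAt (fun s => (u s, v s, w s)) (trajField σ (u t, v t, w t)) t :=
  (h.du t ht).prodMk ((h.dv t ht).prodMk (h.dw t ht))

theorem of_hasDerivAt_field {α : ℝ → ℝ × ℝ × ℝ} (hpos : ∀ t ∈ I, 0 < (α t).1)
    (h : ∀ t ∈ I, HasDerivAt α (trajField σ (α t)) t) :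
    Traj σ (fun t => (α t).1) (fun t => (α t).2.1) (fun t => (α t).2.2) I := by
  refine ⟨hpos, fun t ht => ?_, fun t ht => ?_, fun t ht => ?_⟩
  · exact (hasFDerivAt_fst.comp_hasDerivAt t (h t ht))
  · exact (hasFDerivAt_fst.comp_hasDerivAt t (hasFDerivAt_snd.comp_hasDerivAt t (h t ht)))
  · exact (hasFDerivAt_snd.comp_hasDerivAt t (hasFDerivAt_snd.comp_hasDerivAt t (h t ht)))

/-- Uniqueness for the initial value problem on an open interval. -/
theorem eqOn {u' v' w' : ℝ → ℝ} (h : Traj σ u v w I) (h' : Traj σ u' v' w' I) (hI : IsOpen I)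
    (hc : I.OrdConnected) {t₀ : ℝ} (ht₀ : t₀ ∈ I) (h1 : u t₀ = u' t₀) (h2 : v t₀ = v' t₀)
    (h3 : w t₀ = w' t₀) : EqOn u u' I := by
  set f : ℝ → ℝ × ℝ × ℝ := fun s => (u s, v s, w s)
  set g : ℝ → ℝ × ℝ × ℝ := fun s => (u' s, v' s, w' s)
  have hf : ∀ t ∈ I, ContinuousAt f t := fun t ht => (h.hasDerivAt_prodMk ht).continuousAt
  have hg : ∀ t ∈ I, ContinuousAt g t := fun t ht => (h'.hasDerivAt_prodMk ht).continuousAt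
  -- Connectedness: the set of points near which `f` and `g` agree is open, nonempty and closed in
  -- `I`. Local uniqueness holds because the field is `C^1`, hence Lipschitz, away from `u = 0`.
  have key : I ⊆ {t | f =ᶠ[𝓝 t] g} := by
    have hloc : ∀ t ∈ I, f t = g t → f =ᶠ[𝓝 t] g := by
      intro t ht hfg
      obtain ⟨K, s, hs, hl⟩ := (contDiffAt_trajField σ (x := f t)
        (h.pos t ht).ne').exists_lipschitzOnWith
      refine ODE_solution_unique_of_eventually (v := fun _ => trajField σ) (s := fun _ => s)
        (K := K) (Eventually.of_forall fun _ => hl) ?_ ?_ hfg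
      · filter_upwards [hI.mem_nhds ht, (hf t ht).eventually_mem hs] with r hr hrs
        exact ⟨h.hasDerivAt_prodMk hr, hrs⟩
      · rw [hfg] at hs
        filter_upwards [hI.mem_nhds ht, (hg t ht).eventually_mem hs] with r hr hrs
        exact ⟨h'.hasDerivAt_prodMk hr, hrs⟩
    refine hc.isPreconnected.subset_of_closure_inter_subset isOpen_setOfPred_eventually_nhds
      ⟨t₀, ht₀, hloc t₀ ht₀ (by simp [f, g, h1, h2, h3])⟩ ?_
    rintro t ⟨htc, ht⟩
    refine hloc t ht ?_
    by_contra hne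
    have hev : ∀ᶠ r in 𝓝 t, f r ≠ g r := ((hf t ht).ne_iff_eventually_ne (hg t ht)).1 hne
    obtain ⟨r, hr1, hr2⟩ := mem_closure_iff_nhds.1 htc _ hev
    exact hr1 (EventuallyEq.eq_of_nhds hr2)
  intro t ht
  exact congrArg Prod.fst (EventuallyEq.eq_of_nhds (key ht))

end Traj

/-! ### Continuation past a finite endpoint. -/

theorem exists_tendsto_nhdsLT_of_abs_deriv_le {f f' : ℝ → ℝ} {b M : ℝ}
    (hf : ∀ᶠ t in 𝓝[<] b, HasDerivAt f (f' t) t) (hM : ∀ᶠ t in 𝓝[<] b, |f' t| ≤ M) :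
    ∃ L, Tendsto f (𝓝[<] b) (𝓝 L) := by
  obtain ⟨a, ha, hab⟩ := mem_nhdsLT_iff_exists_Ioo_subset.1 (hf.and hM)
  have ha : a < b := ha
  have hd : ∀ t ∈ Ioo a b, HasDerivAt f (f' t) t := fun t ht => (hab ht).1
  have hM' : ∀ t ∈ Ioo a b, |f' t| ≤ M := fun t ht => (hab ht).2
  have hint : interior (Ioo a b) = Ioo a b := isOpen_Ioo.interior_eq
  have hg : ∀ k : ℝ, ∀ t ∈ Ioo a b, HasDerivAt (fun s => f s + k * s) (f' t + k) t :=
    fun k t ht => ((hd t ht).add ((hasDerivAt_id t).const_mul k)).congr_deriv (by simp)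
  -- `f + M s` increases and `f - M s` decreases. The second bounds the first from above, so the
  -- first converges at `b`.
  have mono : MonotoneOn (fun s => f s + M * s) (Ioo a b) := by
    refine monotoneOn_of_deriv_nonneg (convex_Ioo a b)
      (fun t ht => (hg M t ht).continuousAt.continuousWithinAt)
      (fun t ht => (hg M t (hint ▸ ht)).differentiableAt.differentiableWithinAt) fun t ht => ?_
    rw [hint] at ht
    rw [(hg M t ht).deriv]
    linarith [abs_le.1 (hM' t ht)]
  have anti : AntitoneOn (fun s => f s + -M * s) (Ioo a b) := by
    refine antitoneOn_of_deriv_nonpos (convex_Ioo a b)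
      (fun t ht => (hg _ t ht).continuousAt.continuousWithinAt)
      (fun t ht => (hg _ t (hint ▸ ht)).differentiableAt.differentiableWithinAt) fun t ht => ?_
    rw [hint] at ht
    rw [(hg _ t ht).deriv]
    linarith [abs_le.1 (hM' t ht)]
  obtain ⟨c, hc⟩ := exists_between ha
  have hM0 : 0 ≤ M := (abs_nonneg _).trans (hM' c hc)
  have hbdd : BddAbove ((fun s => f s + M * s) '' Ioo a b) := by
    refine ⟨f c + M * (2 * b - c), ?_⟩
    rintro _ ⟨t, ht, rfl⟩
    rcases le_total t c with h | h
    · have := mono ht hc h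
      dsimp at this ⊢
      nlinarith [hc.2]
    · have := anti hc ht h
      dsimp at this ⊢
      nlinarith [ht.2]
  have h1 := mono.tendsto_nhdsWithin_Ioo_left ⟨c, hc⟩ hbdd
  have h2 : Tendsto (fun s : ℝ => M * s) (𝓝[<] b) (𝓝 (M * b)) :=
    ((continuous_const.mul continuous_id).tendsto b).mono_left nhdsWithin_le_nhds
  exact ⟨_, (h1.sub h2).congr fun t => by ring⟩

namespace Traj

variable {σ : ℝ} {u v w : ℝ → ℝ} {I : Set ℝ}

/-- A solution that stays away from `0` near the finite right endpoint of its interval of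
definition extends beyond this endpoint. -/
theorem extend_right (h : Traj σ u v w I) {b δ : ℝ} (hI : ∀ᶠ t in 𝓝[<] b, t ∈ I)
    (hb : ∀ t ∈ I, t < b) (hδ : 0 < δ) (hu : ∀ᶠ t in 𝓝[<] b, δ ≤ u t) :
    ∃ ε > 0, ∃ u' v' w' : ℝ → ℝ, Traj σ u' v' w' (I ∪ Ico b (b + ε)) ∧ EqOn u' u I := by
  -- `u ≥ δ` bounds `w'`, so `w` converges. Then `w` is bounded and `v` converges, and likewise `u`.
  obtain ⟨l₃, h₃⟩ := exists_tendsto_nhdsLT_of_abs_deriv_le (M := |σ| / δ ^ 3)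
    (hI.mono fun t ht => h.dw t ht) (by
      filter_upwards [hI, hu] with t ht hut
      have := h.pos t ht
      rw [abs_div, abs_of_pos (pow_pos this 3)]
      gcongr)
  have bdd : ∀ {f : ℝ → ℝ} {l : ℝ}, Tendsto f (𝓝[<] b) (𝓝 l) →
      ∀ᶠ t in 𝓝[<] b, |f t| ≤ |l| + 1 := fun hf =>
    (hf.abs.eventually_lt_const (lt_add_one _)).mono fun t ht => ht.le
  obtain ⟨l₂, h₂⟩ := exists_tendsto_nhdsLT_of_abs_deriv_le
    (hI.mono fun t ht => h.dv t ht) (bdd h₃)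
  obtain ⟨l₁, h₁⟩ := exists_tendsto_nhdsLT_of_abs_deriv_le
    (hI.mono fun t ht => h.du t ht) (bdd h₂)
  have hl₁ : 0 < l₁ := hδ.trans_le (ge_of_tendsto h₁ hu)
  obtain ⟨α, hα0, ε₀, hε₀, hα⟩ :=
    (contDiffAt_trajField σ (x := (l₁, l₂, l₃)) hl₁.ne')
      |>.exists_forall_mem_closedBall_exists_eq_forall_mem_Ioo_hasDerivAt₀ b
  have hcα : ContinuousAt α b := (hα b ⟨by linarith, by linarith⟩).continuousAt
  have hev : ∀ᶠ t in 𝓝 b, 0 < (α t).1 := by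
    refine (continuousAt_fst.comp hcα).eventually_const_lt ?_
    simpa [hα0] using hl₁
  obtain ⟨ε₁, hε₁, hpos⟩ := Metric.eventually_nhds_iff_ball.1 hev
  rw [Real.ball_eq_Ioo] at hpos
  set f : ℝ → ℝ × ℝ × ℝ := fun t => (u t, v t, w t) with hfdef
  -- The solution is glued at `b` to the local solution `α` starting from its limit. At `b` the left
  -- derivative is the limit of the derivatives, which the field evaluates to the same vector as the
  -- right derivative.
  set F : ℝ → ℝ × ℝ × ℝ := fun t => if t < b then f t else α t with hF
  have hFb : F b = (l₁, l₂, l₃) := by simp [hF, hα0]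
  have hFf : ∀ t < b, F =ᶠ[𝓝 t] f := fun t ht => by
    filter_upwards [Iio_mem_nhds ht] with s hs
    simp only [hF, if_pos (show s < b from hs)]
  have hFα : ∀ t > b, F =ᶠ[𝓝 t] α := fun t ht => by
    filter_upwards [Ioi_mem_nhds ht] with s hs
    simp only [hF, if_neg (not_lt.2 (le_of_lt (show b < s from hs)))]
  have hlimf : Tendsto f (𝓝[<] b) (𝓝 (l₁, l₂, l₃)) := h₁.prodMk_nhds (h₂.prodMk_nhds h₃)
  have hlimF : Tendsto F (𝓝[<] b) (𝓝 (F b)) := by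
    rw [hFb]
    refine hlimf.congr' ?_
    filter_upwards [self_mem_nhdsWithin] with s hs using (hFf s hs).eq_of_nhds.symm
  have hdF : ∀ t ∈ I, HasDerivAt F (trajField σ (F t)) t := fun t ht => by
    rw [(hFf t (hb t ht)).eq_of_nhds]
    exact (h.hasDerivAt_prodMk ht).congr_of_eventuallyEq (hFf t (hb t ht))
  have hleft : HasDerivWithinAt F (trajField σ (F b)) (Iic b) b := by
    obtain ⟨a, ha, hab⟩ := mem_nhdsLT_iff_exists_Ioo_subset.1 hI
    refine hasDerivWithinAt_Iic_of_tendsto_deriv (s := Ioo a b)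
      (fun t ht => (hdF t (hab ht)).differentiableAt.differentiableWithinAt) ?_
      (Ioo_mem_nhdsLT ha) ?_
    · exact hlimF.mono_left (nhdsWithin_mono _ fun t ht => ht.2)
    · have : ContinuousAt (trajField σ) (F b) :=
        (contDiffAt_trajField σ (by rw [hFb]; exact hl₁.ne')).continuousAt
      refine (this.tendsto.comp hlimF).congr' ?_
      filter_upwards [Ioo_mem_nhdsLT ha] with t ht using (hdF t (hab ht)).deriv.symm
  have hright : HasDerivWithinAt F (trajField σ (F b)) (Ici b) b := by
    have := (hα b ⟨by linarith, by linarith⟩).hasDerivWithinAt (s := Ici b)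
    have hFαb : F b = α b := by simp [hF]
    rw [hFαb]
    refine this.congr (fun t ht => ?_) hFαb
    simp only [hF, if_neg (not_lt.2 (show b ≤ t from ht))]
  have hdb : HasDerivAt F (trajField σ (F b)) b := by
    have := hleft.union hright
    rwa [Iic_union_Ici, hasDerivWithinAt_univ] at this
  refine ⟨min ε₀ ε₁, lt_min hε₀ hε₁, _, _, _, of_hasDerivAt_field (σ := σ) (α := F) ?_ ?_, ?_⟩
  · rintro t (ht | ⟨ht1, ht2⟩)
    · rw [(hFf t (hb t ht)).eq_of_nhds]
      exact h.pos t ht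
    · have := min_le_right ε₀ ε₁
      simp only [hF, if_neg (not_lt.2 ht1)]
      exact hpos t ⟨by linarith, by linarith⟩
  · rintro t (ht | ⟨ht1, ht2⟩)
    · exact hdF t ht
    · rcases ht1.eq_or_lt with rfl | ht1
      · exact hdb
      · have := min_le_left ε₀ ε₁
        rw [(hFα t ht1).eq_of_nhds]
        exact (hα t ⟨by linarith, by linarith⟩).congr_of_eventuallyEq (hFα t ht1)
  · intro t ht
    exact congrArg Prod.fst (hFf t (hb t ht)).eq_of_nhds

/-- A solution that stays away from `0` near the finite left endpoint of its interval of
definition extends beyond this endpoint. -/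
theorem extend_left (h : Traj σ u v w I) {a δ : ℝ} (hI : ∀ᶠ t in 𝓝[>] a, t ∈ I)
    (ha : ∀ t ∈ I, a < t) (hδ : 0 < δ) (hu : ∀ᶠ t in 𝓝[>] a, δ ≤ u t) :
    ∃ ε > 0, ∃ u' v' w' : ℝ → ℝ, Traj σ u' v' w' (I ∪ Ioc (a - ε) a) ∧ EqOn u' u I := by
  have hneg : Tendsto (fun t : ℝ => -t) (𝓝[<] (-a)) (𝓝[>] a) := by
    simpa using tendsto_neg_nhdsLT (a := -a)
  obtain ⟨ε, hε, u', v', w', hT, he⟩ := h.comp_neg.extend_right (b := -a) (hneg.eventually hI)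
    (fun t ht => by linarith [ha (-t) ht]) hδ (hneg.eventually hu)
  have hsub : I ∪ Ioc (a - ε) a ⊆ -(-I ∪ Ico (-a) (-a + ε)) := by
    rintro t (ht | ht)
    · exact Or.inl (by simpa using ht)
    · exact Or.inr ⟨by linarith [ht.2], by linarith [ht.1]⟩
  refine ⟨ε, hε, _, _, _, (neg_neg σ ▸ hT.comp_neg).mono hsub, fun t ht => ?_⟩
  simpa using he (x := -t) (by simpa using ht)

end Traj

/-! ### Maximal solutions -/

theorem IsSolutionOn.eqOn_of_eventuallyEq {φ ψ : ℝ → ℝ} {I J : Set ℝ} (hφ : IsSolutionOn φ I)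
    (hψ : IsSolutionOn ψ J) {t : ℝ} (htI : t ∈ I) (htJ : t ∈ J) (h : φ =ᶠ[𝓝 t] ψ) :
    EqOn φ ψ (I ∩ J) :=
  (hφ.traj.mono inter_subset_left).eqOn (hψ.traj.mono inter_subset_right)
    (hφ.isOpen.inter hψ.isOpen) (hφ.ordConnected.inter hψ.ordConnected) ⟨htI, htJ⟩
    h.eq_of_nhds h.deriv.eq_of_nhds h.deriv.deriv.eq_of_nhds

theorem IsSolutionOn.of_eventuallyEq {φ : ℝ → ℝ} {I : Set ℝ} (hc : I.OrdConnected)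
    (hn : I.Nonempty) (h : ∀ t ∈ I, ∃ ψ J, IsSolutionOn ψ J ∧ t ∈ J ∧ J ⊆ I ∧ EqOn φ ψ J) :
    IsSolutionOn φ I := by
  have hI : IsOpen I := by
    refine isOpen_iff_mem_nhds.2 fun t ht => ?_
    obtain ⟨ψ, J, hψ, htJ, hJI, -⟩ := h t ht
    exact mem_of_superset (hψ.isOpen.mem_nhds htJ) hJI
  refine Traj.isSolutionOn (v := deriv φ) (w := deriv (deriv φ))
    (Traj.congr_of_eventuallyEq fun t ht => ?_) hI hc hn
  obtain ⟨ψ, J, hψ, htJ, hJI, he⟩ := h t ht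
  have he' : φ =ᶠ[𝓝 t] ψ := he.eventuallyEq_of_mem (hψ.isOpen.mem_nhds htJ)
  exact ⟨_, _, _, J, htJ, hψ.traj, he', he'.deriv, he'.deriv.deriv⟩

theorem IsSolutionOn.mono {φ : ℝ → ℝ} {I J : Set ℝ} (h : IsSolutionOn φ I) (hJ : J ⊆ I)
    (ho : IsOpen J) (hc : J.OrdConnected) (hn : J.Nonempty) : IsSolutionOn φ J :=
  (h.traj.mono hJ).isSolutionOn ho hc hn

theorem Set.OrdConnected.union_of_inter {I J : Set ℝ} (hI : I.OrdConnected)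
    (hJ : J.OrdConnected) (h : (I ∩ J).Nonempty) : (I ∪ J).OrdConnected := by
  obtain ⟨x, hx⟩ := h
  exact (IsPreconnected.union x hx.1 hx.2 hI.isPreconnected hJ.isPreconnected).ordConnected

/-- A solution that agrees somewhere with a maximal solution is a restriction of it. -/
theorem IsMaximalSolution.subset_and_eqOn {φ ψ : ℝ → ℝ} {I J : Set ℝ}
    (hφ : IsMaximalSolution φ I) (hψ : IsSolutionOn ψ J) {t : ℝ} (htI : t ∈ I) (htJ : t ∈ J)
    (h : φ =ᶠ[𝓝 t] ψ) : J ⊆ I ∧ EqOn ψ φ J := by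
  classical
  have hφI := hφ.isSolutionOn
  have he := hφI.eqOn_of_eventuallyEq hψ htI htJ h
  -- The two solutions agree on `I ∩ J`, so they glue to a solution on `I ∪ J`, and maximality gives
  -- `I ∪ J = I`.
  set χ : ℝ → ℝ := fun s => if s ∈ I then φ s else ψ s
  have hχI : EqOn χ φ I := fun s hs => if_pos hs
  have hχJ : EqOn χ ψ J := fun s hs => by
    by_cases hsI : s ∈ I
    · rw [hχI hsI]; exact he ⟨hsI, hs⟩
    · exact if_neg hsI
  have hχ : IsSolutionOn χ (I ∪ J) := by
    refine .of_eventuallyEq (hφI.ordConnected.union_of_inter hψ.ordConnected ⟨t, htI, htJ⟩)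
      ⟨t, Or.inl htI⟩ ?_
    rintro s (hs | hs)
    · exact ⟨φ, I, hφI, hs, subset_union_left, hχI⟩
    · exact ⟨ψ, J, hψ, hs, subset_union_right, hχJ⟩
  have hJI : J ⊆ I := by
    have := hφ.maximal χ _ hχ subset_union_left hχI
    rw [← this]; exact subset_union_right
  exact ⟨hJI, fun s hs => (he ⟨hJI hs, hs⟩).symm⟩

/-- Every solution is a restriction of a maximal one. -/
theorem IsSolutionOn.exists_maximal {u : ℝ → ℝ} {I : Set ℝ} (h : IsSolutionOn u I) :
    ∃ φ J, IsMaximalSolution φ J ∧ I ⊆ J ∧ EqOn φ u I := by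
  classical
  obtain ⟨t₀, ht₀⟩ := h.nonempty
  -- No Zorn argument is needed: by uniqueness any two extensions of `u` agree where both are
  -- defined, so the union of all their domains carries a single solution.
  set J : Set ℝ := {t | ∃ ψ K, IsSolutionOn ψ K ∧ I ⊆ K ∧ EqOn ψ u I ∧ t ∈ K} with hJ
  have hex : ∀ t, ∃ y : ℝ, ∀ ψ K, IsSolutionOn ψ K → I ⊆ K → EqOn ψ u I → t ∈ K → y = ψ t := by
    intro t
    by_cases ht : t ∈ J
    · obtain ⟨ψ, K, hψ, hIK, he, htK⟩ := ht
      refine ⟨ψ t, fun ψ' K' hψ' hIK' he' htK' => ?_⟩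
      refine hψ.eqOn_of_eventuallyEq hψ' (hIK ht₀) (hIK' ht₀) ?_ ⟨htK, htK'⟩
      exact (he.trans he'.symm).eventuallyEq_of_mem (h.isOpen.mem_nhds ht₀)
    · exact ⟨0, fun ψ K h1 h2 h3 h4 => absurd ⟨ψ, K, h1, h2, h3, h4⟩ ht⟩
  choose φ hφ using hex
  have hIJ : I ⊆ J := fun t ht => ⟨u, I, h, Subset.rfl, fun _ _ => rfl, ht⟩
  have hφu : EqOn φ u I := fun t ht => hφ t u I h Subset.rfl (fun _ _ => rfl) ht
  have hsol : IsSolutionOn φ J := by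
    refine .of_eventuallyEq ?_ ⟨t₀, hIJ ht₀⟩ ?_
    · have : IsPreconnected J := by
        refine isPreconnected_of_forall t₀ fun t ht => ?_
        obtain ⟨ψ, K, hψ, hIK, he, htK⟩ := ht
        exact ⟨K, fun s hs => ⟨ψ, K, hψ, hIK, he, hs⟩, hIK ht₀, htK,
          hψ.ordConnected.isPreconnected⟩
      exact this.ordConnected
    · rintro t ⟨ψ, K, hψ, hIK, he, htK⟩
      exact ⟨ψ, K, hψ, htK, fun s hs => ⟨ψ, K, hψ, hIK, he, hs⟩,
        fun s hs => hφ s ψ K hψ hIK he hs⟩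
  refine ⟨φ, J, ⟨hsol, fun ψ K hψ hJK he => ?_⟩, hIJ, hφu⟩
  exact Subset.antisymm (fun t ht => ⟨ψ, K, hψ, hIJ.trans hJK,
    fun s hs => (he (hIJ hs)).trans (hφu hs), ht⟩) hJK

/-! ### Comparison of increments, used in place of integrating inequalities. -/

theorem sub_le_sub_of_hasDerivAt_le {f f' g g' : ℝ → ℝ} {s t : ℝ} (hst : s ≤ t)
    (hf : ∀ r ∈ Icc s t, HasDerivAt f (f' r) r) (hg : ∀ r ∈ Icc s t, HasDerivAt g (g' r) r)
    (h : ∀ r ∈ Icc s t, f' r ≤ g' r) : f t - f s ≤ g t - g s := by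
  have hd : ∀ r ∈ Icc s t, HasDerivAt (fun x => g x - f x) (g' r - f' r) r :=
    fun r hr => (hg r hr).sub (hf r hr)
  have mono : MonotoneOn (fun x => g x - f x) (Icc s t) := by
    refine monotoneOn_of_deriv_nonneg (convex_Icc s t)
      (fun r hr => (hd r hr).continuousAt.continuousWithinAt)
      (fun r hr => (hd r (interior_subset hr)).differentiableAt.differentiableWithinAt)
      fun r hr => ?_
    rw [(hd r (interior_subset hr)).deriv]
    linarith [h r (interior_subset hr)]
  have := mono (left_mem_Icc.2 hst) (right_mem_Icc.2 hst) hst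
  dsimp at this
  linarith

theorem sub_le_mul_of_hasDerivAt_le {f f' : ℝ → ℝ} {s t C : ℝ} (hst : s ≤ t)
    (hf : ∀ r ∈ Icc s t, HasDerivAt f (f' r) r) (h : ∀ r ∈ Icc s t, f' r ≤ C) :
    f t - f s ≤ C * (t - s) := by
  have := sub_le_sub_of_hasDerivAt_le hst hf
    (fun r _ => ((hasDerivAt_id r).const_mul C).congr_deriv (mul_one C)) h
  dsimp at this
  linarith

theorem mul_le_sub_of_le_hasDerivAt {f f' : ℝ → ℝ} {s t C : ℝ} (hst : s ≤ t)
    (hf : ∀ r ∈ Icc s t, HasDerivAt f (f' r) r) (h : ∀ r ∈ Icc s t, C ≤ f' r) :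
    C * (t - s) ≤ f t - f s := by
  have := sub_le_sub_of_hasDerivAt_le hst
    (fun r _ => ((hasDerivAt_id r).const_mul C).congr_deriv (mul_one C)) hf h
  dsimp at this
  linarith

/-! ### Behaviour at a finite endpoint. -/

namespace Traj

variable {u v w : ℝ → ℝ} {I : Set ℝ}

theorem w_le {σ s t : ℝ} (hσ : 0 ≤ σ) (h : Traj σ u v w I) (hst : s ≤ t) (hI : Icc s t ⊆ I) :
    w s ≤ w t := by
  have := mul_le_sub_of_le_hasDerivAt hst (fun r hr => h.dw r (hI hr)) (C := 0) fun r hr =>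
    div_nonneg hσ (pow_nonneg (h.pos r (hI hr)).le 3)
  linarith

theorem le_w {σ s t : ℝ} (hσ : σ ≤ 0) (h : Traj σ u v w I) (hst : s ≤ t) (hI : Icc s t ⊆ I) :
    w t ≤ w s := by
  have := sub_le_mul_of_hasDerivAt_le hst (fun r hr => h.dw r (hI hr)) (C := 0) fun r hr =>
    div_nonpos_of_nonpos_of_nonneg hσ (pow_nonneg (h.pos r (hI hr)).le 3)
  linarith

/-- Forward in time, a solution stays away from `0` on bounded intervals. -/
theorem exists_pos_le_nhdsLT {a b : ℝ} (hab : a < b) (h : Traj 1 u v w (Ioo a b)) :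
    ∃ δ > 0, ∀ᶠ t in 𝓝[<] b, δ ≤ u t := by
  obtain ⟨c, hc⟩ := exists_between hab
  have hsub : ∀ {s t}, c ≤ s → t < b → Icc s t ⊆ Ioo a b := fun hs ht r hr =>
    ⟨hc.1.trans_le (hs.trans hr.1), hr.2.trans_lt ht⟩
  -- If `u` comes arbitrarily close to `0`, then `v ≥ -D` forces `u ≤ D (b - t)`. Hence `w' ≥ 1 / (D
  -- (b - t)) ^ 3`, and two integrations make `v` positive near `b`, so `u` increases there and
  -- cannot come close to `0`.
  by_contra! hcon
  obtain ⟨D, hD, hv⟩ : ∃ D > 0, ∀ t, c ≤ t → t < b → -D ≤ v t := by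
    refine ⟨|v c| + |w c| * (b - c) + 1, by nlinarith [abs_nonneg (v c), abs_nonneg (w c), hc.2],
      fun t hct htb => ?_⟩
    have := mul_le_sub_of_le_hasDerivAt hct (fun r hr => h.dv r (hsub le_rfl htb hr)) (C := w c)
      fun r hr => h.w_le zero_le_one hr.1 (hsub le_rfl (hr.2.trans_lt htb))
    nlinarith [neg_abs_le (v c), neg_abs_le (w c), abs_nonneg (w c)]
  have hu : ∀ t, c ≤ t → t < b → u t ≤ D * (b - t) := by
    intro t hct htb
    refine le_of_forall_pos_le_add fun δ hδ => ?_
    have := (hcon δ hδ).and_eventually (Ioo_mem_nhdsLT htb)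
    obtain ⟨s, hs, hts, hsb⟩ := this.exists
    have := mul_le_sub_of_le_hasDerivAt hts.le (fun r hr => h.du r (hsub hct hsb hr)) (C := -D)
      fun r hr => hv r (hct.trans hr.1) (hr.2.trans_lt hsb)
    nlinarith
  -- Chosen so that `k / (b - t) ^ 2` has derivative exactly `1 / (D (b - t)) ^ 3`.
  set k := 1 / (2 * D ^ 3) with hk
  have hk0 : 0 < k := by positivity
  set A := |w c| + k / (b - c) ^ 2 with hA
  have hw : ∀ t, c ≤ t → t < b → k / (b - t) ^ 2 - A ≤ w t := by
    intro t hct htb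
    have := sub_le_sub_of_hasDerivAt_le (f := fun r => k / (b - r) ^ 2)
      (f' := fun r => 2 * k / (b - r) ^ 3) hct (fun r hr => ?_)
      (fun r hr => h.dw r (hsub le_rfl htb hr)) (fun r hr => ?_)
    · linarith [neg_abs_le (w c)]
    · have hbr : b - r ≠ 0 := by linarith [hr.2]
      refine ((((hasDerivAt_id r).const_sub b).fun_pow 2).fun_inv (pow_ne_zero 2 hbr)
        |>.const_mul k).congr_deriv ?_
      simp only [id]
      field_simp
      norm_num
      ring
    · have hbr : 0 < b - r := by linarith [hr.2]
      have hur := hu r hr.1 (hr.2.trans_lt htb)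
      have hpr := h.pos r (hsub le_rfl htb hr)
      have : 2 * k / (b - r) ^ 3 = 1 / (D * (b - r)) ^ 3 := by
        rw [hk]; field_simp
      rw [this]
      gcongr
  set B := |v c| + k / (b - c) + A * (b - c) + 1 with hB
  have hbc : 0 < b - c := by linarith [hc.2]
  have hA0 : 0 ≤ A := by positivity
  have hB0 : 0 < B := by positivity
  have hv2 : ∀ t, c ≤ t → t < b → k / (b - t) - B ≤ v t := by
    intro t hct htb
    have := sub_le_sub_of_hasDerivAt_le (f := fun r => k / (b - r) - A * r)
      (f' := fun r => k / (b - r) ^ 2 - A) hct (fun r hr => ?_)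
      (fun r hr => h.dv r (hsub le_rfl htb hr)) (fun r hr => ?_)
    · nlinarith [neg_abs_le (v c)]
    · have hbr : b - r ≠ 0 := by linarith [hr.2]
      refine (((((hasDerivAt_id r).const_sub b)).fun_inv hbr
        |>.const_mul k).sub ((hasDerivAt_id r).const_mul A)).congr_deriv ?_
      simp only [id]
      field_simp
    · exact hw r hr.1 (hr.2.trans_lt htb)
  -- Beyond `t₁` one has `b - t ≤ k / B`, so the lower bound `k / (b - t) - B` for `v` is
  -- nonnegative.
  set t₁ := b - min (b - c) (k / B) with ht₁
  have hm : 0 < min (b - c) (k / B) := lt_min hbc (by positivity)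
  have hct₁ : c ≤ t₁ := by linarith [min_le_left (b - c) (k / B)]
  have ht₁b : t₁ < b := by linarith
  have hfin : ∀ t, t₁ ≤ t → t < b → u t₁ ≤ u t := by
    intro t ht htb
    have := mul_le_sub_of_le_hasDerivAt ht (fun r hr => h.du r (hsub hct₁ htb hr)) (C := 0)
      fun r hr => ?_
    · linarith
    · refine le_trans ?_ (hv2 r (hct₁.trans hr.1) (hr.2.trans_lt htb))
      have hbr : 0 < b - r := by linarith [hr.2]
      have : b - r ≤ k / B := by linarith [hr.1, min_le_right (b - c) (k / B)]
      rw [sub_nonneg, le_div_iff₀ hbr]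
      rwa [le_div_iff₀ hB0, mul_comm] at this
  obtain ⟨s, hs, hs1, hs2⟩ := ((hcon (u t₁) (h.pos _ (hsub (s := t₁) (t := t₁) hct₁ ht₁b
    ⟨le_rfl, le_rfl⟩))).and_eventually (Ioo_mem_nhdsLT ht₁b)).exists
  linarith [hfin s hs1.le hs2]

/-- A solution of the reflected equation has a limit at a finite right endpoint. -/
theorem exists_tendsto_nhdsLT {a b : ℝ} (hab : a < b) (h : Traj (-1) u v w (Ioo a b)) :
    ∃ L, 0 ≤ L ∧ Tendsto u (𝓝[<] b) (𝓝 L) := by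
  obtain ⟨c, hc⟩ := exists_between hab
  have hsub : ∀ {s t}, c ≤ s → t < b → Icc s t ⊆ Ioo a b := fun hs ht r hr =>
    ⟨hc.1.trans_le (hs.trans hr.1), hr.2.trans_lt ht⟩
  -- Here `w` decreases, so `v` is bounded above. Then `u - D t` decreases and is bounded below
  -- because `u > 0`.
  obtain ⟨D, hv⟩ : ∃ D, ∀ t, c ≤ t → t < b → v t ≤ D := by
    refine ⟨v c + |w c| * (b - c), fun t hct htb => ?_⟩
    have := sub_le_mul_of_hasDerivAt_le hct (fun r hr => h.dv r (hsub le_rfl htb hr)) (C := w c)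
      fun r hr => h.le_w (by norm_num) hr.1 (hsub le_rfl (hr.2.trans_lt htb))
    nlinarith [le_abs_self (w c), abs_nonneg (w c)]
  have anti : AntitoneOn (fun t => u t - D * t) (Ioo c b) := by
    intro s hs t ht hst
    have := sub_le_mul_of_hasDerivAt_le hst (fun r hr => h.du r (hsub hs.1.le ht.2 hr)) (C := D)
      fun r hr => hv r (hs.1.le.trans hr.1) (hr.2.trans_lt ht.2)
    dsimp
    linarith
  have hpos : ∀ t ∈ Ioo c b, 0 < u t := fun t ht => h.pos t ⟨hc.1.trans ht.1, ht.2⟩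
  have hbdd : BddBelow ((fun t => u t - D * t) '' Ioo c b) := by
    refine ⟨-|D| * (|b| + |c|), ?_⟩
    rintro _ ⟨t, ht, rfl⟩
    have h1 := hpos t ht
    have h2 : |t| ≤ |b| + |c| := abs_le.2
      ⟨by linarith [ht.1, neg_abs_le c, abs_nonneg b], by linarith [ht.2, le_abs_self b, abs_nonneg c]⟩
    have h3 : D * t ≤ |D| * (|b| + |c|) := (le_abs_self _).trans (by rw [abs_mul]; gcongr)
    dsimp
    linarith
  have h1 := anti.tendsto_nhdsWithin_Ioo_left (nonempty_Ioo.2 hc.2) hbdd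
  have h2 : Tendsto (fun s : ℝ => D * s) (𝓝[<] b) (𝓝 (D * b)) :=
    ((continuous_const.mul continuous_id).tendsto b).mono_left nhdsWithin_le_nhds
  have h3 := (h1.add h2).congr (f₂ := u) fun t => by ring
  refine ⟨_, ge_of_tendsto h3 ?_, h3⟩
  filter_upwards [Ioo_mem_nhdsLT hc.2] with t ht using (hpos t ht).le

end Traj

theorem Set.OrdConnected.exists_Ioo_subset_of_bddAbove {I : Set ℝ} (hI : I.OrdConnected) (ho : IsOpen I)
    (hn : I.Nonempty) (hb : BddAbove I) :
    ∃ a b, a < b ∧ Ioo a b ⊆ I ∧ ∀ t ∈ I, t < b := by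
  obtain ⟨x, hx⟩ := hn
  have hlub := isLUB_csSup ⟨x, hx⟩ hb
  have hlt : ∀ t ∈ I, t < sSup I := fun t ht => by
    refine (hlub.1 ht).lt_of_ne fun he => ?_
    obtain ⟨y, hyI, hy⟩ := (((ho.eventually_mem ht).filter_mono nhdsWithin_le_nhds).and
      (eventually_mem_nhdsWithin (s := Ioi t))).exists
    exact absurd (hlub.1 hyI) (not_le.2 (he ▸ hy))
  refine ⟨x, sSup I, hlt x hx, fun t ht => ?_, hlt⟩
  obtain ⟨y, hy, hty⟩ := exists_lt_of_lt_csSup ⟨x, hx⟩ ht.2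
  exact hI.out hx hy ⟨ht.1.le, hty.le⟩

/-- Maximal solutions are defined near `+∞`. -/
theorem IsMaximalSolution.not_bddAbove {φ : ℝ → ℝ} {I : Set ℝ} (h : IsMaximalSolution φ I) :
    ¬ BddAbove I := by
  intro hb
  have hs := h.isSolutionOn
  obtain ⟨a, b, hab, hI, hlt⟩ :=
    hs.ordConnected.exists_Ioo_subset_of_bddAbove hs.isOpen hs.nonempty hb
  obtain ⟨δ, hδ, hu⟩ := (hs.traj.mono hI).exists_pos_le_nhdsLT hab
  obtain ⟨ε, hε, u', v', w', hT, he⟩ := hs.traj.extend_right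
    (mem_of_superset (Ioo_mem_nhdsLT hab) hI) hlt hδ hu
  -- Rewritten as a union of open sets, so that the extension has an open domain.
  have hJ : I ∪ Ico b (b + ε) = I ∪ Ioo a (b + ε) := by
    ext t
    constructor
    · rintro (ht | ht)
      · exact Or.inl ht
      · exact Or.inr ⟨hab.trans_le ht.1, ht.2⟩
    · rintro (ht | ht)
      · exact Or.inl ht
      · rcases lt_or_ge t b with htb | htb
        · exact Or.inl (hI ⟨ht.1, htb⟩)
        · exact Or.inr ⟨htb, ht.2⟩
  rw [hJ] at hT
  obtain ⟨c, hc⟩ := exists_between hab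
  have hsol := hT.isSolutionOn (hs.isOpen.union isOpen_Ioo)
    (hs.ordConnected.union_of_inter ordConnected_Ioo ⟨c, hI hc, hc.1, by linarith [hc.2]⟩)
    (hs.nonempty.inl)
  have := h.maximal u' _ hsol subset_union_left he
  have hbI : b ∈ I := this ▸ Or.inr ⟨hab, by linarith⟩
  exact lt_irrefl _ (hlt b hbI)

theorem Set.OrdConnected.neg_real {I : Set ℝ} (hI : I.OrdConnected) : (-I).OrdConnected :=
  ⟨fun _ hx _ hy _ hz => hI.out hy hx ⟨neg_le_neg hz.2, neg_le_neg hz.1⟩⟩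

/-- The reflected solution has a limit `L ≥ 0` at the finite endpoint. If `L > 0`, then
`extend_left` contradicts maximality. -/
theorem IsMaximalSolution.eq_Ioi {φ : ℝ → ℝ} {I : Set ℝ} (h : IsMaximalSolution φ I)
    (hb : BddBelow I) : ∃ a, I = Ioi a ∧ Tendsto φ (𝓝[>] a) (𝓝 0) := by
  have hs := h.isSolutionOn
  obtain ⟨a', b', hab', hI', hlt'⟩ :=
    hs.ordConnected.neg_real.exists_Ioo_subset_of_bddAbove hs.isOpen.neg hs.nonempty.neg hb.neg
  obtain ⟨a, rfl⟩ : ∃ a, -a = b' := ⟨-b', neg_neg _⟩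
  have hlt : ∀ t ∈ I, a < t := fun t ht => by
    linarith [hlt' (-t) (by simpa using ht)]
  have hIoi : I = Ioi a := by
    refine Subset.antisymm hlt fun t ht => ?_
    obtain ⟨y, hyI, hy⟩ := not_bddAbove_iff.1 h.not_bddAbove t
    have ha : max a' (-t) < -a := max_lt hab' (neg_lt_neg ht)
    obtain ⟨s, hs1, hs2⟩ := exists_between ha
    have hsI : -s ∈ I := hI' ⟨(le_max_left _ _).trans_lt hs1, hs2⟩
    exact hs.ordConnected.out hsI hyI ⟨by linarith [le_max_right a' (-t)], hy.le⟩
  refine ⟨a, hIoi, ?_⟩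
  have hneg : Tendsto (fun t : ℝ => -t) (𝓝[>] a) (𝓝[<] (-a)) := tendsto_neg_nhdsGT
  obtain ⟨L, hL0, hL⟩ := (hs.traj.comp_neg.mono hI').exists_tendsto_nhdsLT hab'
  have hφ : Tendsto φ (𝓝[>] a) (𝓝 L) := (hL.comp hneg).congr fun t => by simp
  rcases hL0.eq_or_lt with rfl | hL0
  · exact hφ
  exfalso
  have hmem : ∀ᶠ t in 𝓝[>] a, t ∈ I := hIoi ▸ self_mem_nhdsWithin
  obtain ⟨ε, hε, u', v', w', hT, he⟩ := hs.traj.extend_left hmem hlt (half_pos hL0)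
    ((hφ.eventually_const_lt (half_lt_self hL0)).mono fun t ht => ht.le)
  have hJ : I ∪ Ioc (a - ε) a = Ioi (a - ε) := by
    rw [hIoi, union_comm, Ioc_union_Ioi_eq_Ioi (by linarith)]
  rw [hJ] at hT
  have := h.maximal u' _ (hT.isSolutionOn isOpen_Ioi ordConnected_Ioi nonempty_Ioi)
    (hJ ▸ subset_union_left) he
  rw [hIoi, Ioi_inj] at this
  linarith

theorem IsMaximalSolution.eq_univ {φ : ℝ → ℝ} {I : Set ℝ} (h : IsMaximalSolution φ I)
    (hb : ¬ BddBelow I) : I = univ := by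
  refine eq_univ_of_forall fun t => ?_
  obtain ⟨x, hx, hxt⟩ := not_bddBelow_iff.1 hb t
  obtain ⟨y, hy, hty⟩ := not_bddAbove_iff.1 h.not_bddAbove t
  exact h.isSolutionOn.ordConnected.out hx hy ⟨hxt.le, hty.le⟩

/-! ### Elementary asymptotics at infinity -/

theorem exists_tendsto_atTop_of_le {f : ℝ → ℝ} {a B : ℝ}
    (hm : ∀ s t, a < s → s ≤ t → f s ≤ f t) (hB : ∀ t, a < t → f t ≤ B) :
    ∃ L, Tendsto f atTop (𝓝 L) := by
  have hmax : ∀ t : ℝ, a < max t (a + 1) := fun t => (lt_add_one a).trans_le (le_max_right _ _)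
  have h := tendsto_atTop_ciSup (f := fun t => f (max t (a + 1)))
    (fun s t hst => hm _ _ (hmax s) (max_le_max_right _ hst))
    ⟨B, by rintro _ ⟨t, rfl⟩; exact hB _ (hmax t)⟩
  refine ⟨_, h.congr' ?_⟩
  filter_upwards [eventually_ge_atTop (a + 1)] with t ht
  rw [max_eq_left ht]

theorem exists_tendsto_atTop_of_ge {f : ℝ → ℝ} {a B : ℝ}
    (hm : ∀ s t, a < s → s ≤ t → f t ≤ f s) (hB : ∀ t, a < t → B ≤ f t) :
    ∃ L, Tendsto f atTop (𝓝 L) := by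
  obtain ⟨L, hL⟩ := exists_tendsto_atTop_of_le (f := fun t => -f t) (a := a) (B := -B)
    (fun s t hs hst => neg_le_neg (hm s t hs hst)) fun t ht => neg_le_neg (hB t ht)
  exact ⟨-L, by simpa using hL.neg⟩

/-- A form of l'Hôpital's rule: beyond some `T` the derivative is at most `ε / 2 * t ^ n`, and the
integration constant `f T` is negligible against `t ^ (n + 1)`. -/
theorem tendsto_div_pow_zero_of_hasDerivAt {f f' : ℝ → ℝ} {n : ℕ}
    (hf : ∀ᶠ t in atTop, HasDerivAt f (f' t) t)
    (h : Tendsto (fun t => f' t / t ^ n) atTop (𝓝 0)) :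
    Tendsto (fun t => f t / t ^ (n + 1)) atTop (𝓝 0) := by
  rw [Metric.tendsto_atTop']
  intro ε hε
  have h1 : ∀ᶠ t in atTop, |f' t / t ^ n| < ε / 2 := by
    simpa using h.abs.eventually_lt_const (show |(0 : ℝ)| < ε / 2 by simpa using half_pos hε)
  obtain ⟨T, hT⟩ := eventually_atTop.1 ((hf.and h1).and (eventually_gt_atTop 0))
  have hT0 : 0 < T := (hT T le_rfl).2
  have hb : ∀ r, T ≤ r → |f' r| ≤ ε / 2 * r ^ n := fun r hr => by
    have := (hT r hr).1.2
    have hr0 : 0 < r := (hT r hr).2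
    rw [abs_div, abs_of_pos (pow_pos hr0 n), div_lt_iff₀ (pow_pos hr0 n)] at this
    exact this.le
  have hd : ∀ c r : ℝ, HasDerivAt (fun x : ℝ => c / (n + 1) * x ^ (n + 1)) (c * r ^ n) r :=
    fun c r => ((hasDerivAt_pow (n + 1) r).const_mul (c / (n + 1))).congr_deriv (by
      simp [field])
  have key : ∀ t, T ≤ t → |f t| ≤ |f T| + ε / 2 * t ^ (n + 1) := by
    intro t ht
    have u1 := sub_le_sub_of_hasDerivAt_le ht (fun r hr => (hT r hr.1).1.1)
      (fun r _ => hd (ε / 2) r) fun r hr => (abs_le.1 (hb r hr.1)).2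
    have u2 := sub_le_sub_of_hasDerivAt_le ht (fun r _ => hd (-(ε / 2)) r)
      (fun r hr => (hT r hr.1).1.1) fun r hr => by linarith [(abs_le.1 (hb r hr.1)).1]
    have hc : 0 ≤ ε / 2 / (n + 1) * T ^ (n + 1) := by positivity
    have hc' : ε / 2 / (n + 1) * t ^ (n + 1) ≤ ε / 2 * t ^ (n + 1) := by
      have := hT0.trans_le ht
      exact mul_le_mul_of_nonneg_right (div_le_self (by positivity)
        (by linarith [(Nat.cast_nonneg n : (0 : ℝ) ≤ n)])) (by positivity)
    rw [neg_div, neg_mul, neg_mul] at u2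
    exact abs_le.2 ⟨by linarith [neg_abs_le (f T)], by linarith [le_abs_self (f T)]⟩
  have h2 : Tendsto (fun t : ℝ => |f T| / t ^ (n + 1)) atTop (𝓝 0) :=
    tendsto_const_nhds.div_atTop (tendsto_pow_atTop n.succ_ne_zero)
  obtain ⟨T', hT'⟩ := eventually_atTop.1 (h2.eventually_lt_const (half_pos hε))
  refine ⟨max T T', fun t ht => ?_⟩
  have htT : T ≤ t := ((le_max_left _ _).trans_lt ht).le
  have htp : 0 < t ^ (n + 1) := pow_pos (hT0.trans_le htT) _
  have h3 := hT' t ((le_max_right _ _).trans_lt ht).le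
  rw [div_lt_iff₀ htp] at h3
  rw [Real.dist_eq, sub_zero, abs_div, abs_of_pos htp, div_lt_iff₀ htp]
  linarith [key t htT]

theorem tendsto_div_pow_of_hasDerivAt {f f' : ℝ → ℝ} {n : ℕ} {c : ℝ}
    (hf : ∀ᶠ t in atTop, HasDerivAt f (f' t) t)
    (h : Tendsto (fun t => f' t / t ^ n) atTop (𝓝 c)) :
    Tendsto (fun t => f t / t ^ (n + 1)) atTop (𝓝 (c / (n + 1))) := by
  have hd : ∀ r : ℝ, HasDerivAt (fun x : ℝ => c / (n + 1) * x ^ (n + 1)) (c * r ^ n) r :=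
    fun r => ((hasDerivAt_pow (n + 1) r).const_mul (c / (n + 1))).congr_deriv (by
      simp [field])
  have h1 := tendsto_div_pow_zero_of_hasDerivAt (n := n)
    (f := fun t => f t - c / (n + 1) * t ^ (n + 1)) (f' := fun t => f' t - c * t ^ n)
    (hf.mono fun t ht => ht.sub (hd t)) (by
      have := h.sub_const c
      rw [sub_self] at this
      refine this.congr' ?_
      filter_upwards [eventually_gt_atTop 0] with t ht
      have := (pow_pos ht n).ne'
      field_simp)
  have h2 := h1.add_const (c / (n + 1))
  rw [zero_add] at h2
  refine h2.congr' ?_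
  filter_upwards [eventually_gt_atTop 0] with t ht
  have := (pow_pos ht (n + 1)).ne'
  field_simp
  ring

theorem hasDerivAt_neg_mul_rpow {C p r : ℝ} (hp : 0 < p) (hr : 0 < r) :
    HasDerivAt (fun x : ℝ => -(C / p * x ^ (-p))) (C * r ^ (-(p + 1))) r := by
  refine (((Real.hasDerivAt_rpow_const (p := -p) (Or.inl hr.ne')).const_mul (C / p)).neg).congr_deriv
    ?_
  rw [show -p - 1 = -(p + 1) by ring]
  field_simp

/-- A function tending to `0` whose derivative is `O(t ^ (-(p + 1)))` is `O(t ^ (-p))`. -/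
theorem abs_le_rpow_of_tendsto_zero {f f' : ℝ → ℝ} {a C p : ℝ} (ha : 0 ≤ a) (hp : 0 < p)
    (hC : 0 ≤ C) (hf : ∀ t, a < t → HasDerivAt f (f' t) t)
    (hf' : ∀ t, a < t → |f' t| ≤ C * t ^ (-(p + 1))) (h0 : Tendsto f atTop (𝓝 0)) :
    ∀ t, a < t → |f t| ≤ C / p * t ^ (-p) := by
  intro t ht
  have hpos : ∀ r, t ≤ r → 0 < r := fun r hr => ha.trans_lt (ht.trans_le hr)
  have key : ∀ s, t ≤ s → f t - f s ≤ C / p * t ^ (-p) ∧ f s - f t ≤ C / p * t ^ (-p) := by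
    intro s hs
    have hs0 : 0 ≤ C / p * s ^ (-p) := by have := hpos s hs; positivity
    have u1 := sub_le_sub_of_hasDerivAt_le hs (fun r hr => hf r (ht.trans_le hr.1))
      (fun r hr => hasDerivAt_neg_mul_rpow (C := C) hp (hpos r hr.1))
      fun r hr => (abs_le.1 (hf' r (ht.trans_le hr.1))).2
    have u2 := sub_le_sub_of_hasDerivAt_le hs (fun r hr => (hf r (ht.trans_le hr.1)).neg)
      (fun r hr => hasDerivAt_neg_mul_rpow (C := C) hp (hpos r hr.1))
      fun r hr => by linarith [(abs_le.1 (hf' r (ht.trans_le hr.1))).1]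
    simp only [Pi.neg_apply] at u2
    constructor <;> linarith
  have l1 : Tendsto (fun s => f t - f s) atTop (𝓝 (f t - 0)) := h0.const_sub _
  have l2 : Tendsto (fun s => f s - f t) atTop (𝓝 (0 - f t)) := h0.sub_const _
  have r1 := le_of_tendsto l1 ((eventually_ge_atTop t).mono fun s hs => (key s hs).1)
  have r2 := le_of_tendsto l2 ((eventually_ge_atTop t).mono fun s hs => (key s hs).2)
  exact abs_le.2 ⟨by linarith, by linarith⟩

/-- Adding and subtracting `C / p * t ^ (-p)` gives a decreasing and an increasing function. The
second bounds the first from below, and the correction tends to `0`. -/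
theorem exists_tendsto_atTop_of_abs_deriv_le_rpow {f f' : ℝ → ℝ} {a C p : ℝ} (ha : 0 ≤ a)
    (hp : 0 < p) (hC : 0 ≤ C) (hf : ∀ t, a < t → HasDerivAt f (f' t) t)
    (hf' : ∀ t, a < t → |f' t| ≤ C * t ^ (-(p + 1))) : ∃ L, Tendsto f atTop (𝓝 L) := by
  have hpos : ∀ s r, a < s → s ≤ r → 0 < r := fun s r hs hr => ha.trans_lt (hs.trans_le hr)
  have hg0 : ∀ s, a < s → 0 ≤ C / p * s ^ (-p) := fun s hs => by
    have := hpos s s hs le_rfl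
    positivity
  have anti : ∀ s t, a < s → s ≤ t → f t + C / p * t ^ (-p) ≤ f s + C / p * s ^ (-p) := by
    intro s t hs hst
    have u1 := sub_le_sub_of_hasDerivAt_le hst (fun r hr => hf r (hs.trans_le hr.1))
      (fun r hr => hasDerivAt_neg_mul_rpow (C := C) hp (hpos s r hs hr.1))
      fun r hr => (abs_le.1 (hf' r (hs.trans_le hr.1))).2
    linarith
  have mono : ∀ s t, a < s → s ≤ t → f s - C / p * s ^ (-p) ≤ f t - C / p * t ^ (-p) := by
    intro s t hs hst
    have u2 := sub_le_sub_of_hasDerivAt_le hst (fun r hr => (hf r (hs.trans_le hr.1)).neg)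
      (fun r hr => hasDerivAt_neg_mul_rpow (C := C) hp (hpos s r hs hr.1))
      fun r hr => by linarith [(abs_le.1 (hf' r (hs.trans_le hr.1))).1]
    simp only [Pi.neg_apply] at u2
    linarith
  obtain ⟨L, hL⟩ := exists_tendsto_atTop_of_ge (f := fun t => f t + C / p * t ^ (-p))
    (a := a + 1) (B := f (a + 1) - C / p * (a + 1) ^ (-p))
    (fun s t hs hst => anti s t (by linarith) hst) fun t ht => by
      linarith [mono (a + 1) t (by linarith) ht.le, hg0 t (by linarith)]
  have := hL.sub ((tendsto_rpow_neg_atTop hp).const_mul (C / p))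
  exact ⟨_, this.congr fun t => by ring⟩

/-! ### Behaviour at `+∞`: parabolic or with convergent slope. -/

namespace Traj

variable {σ a : ℝ} {u v w : ℝ → ℝ}

theorem not_v_le (h : Traj σ u v w (Ioi a)) {T k : ℝ} (hT : a < T) (hk : 0 < k)
    (hv : ∀ t, T ≤ t → v t ≤ -k) : False := by
  have huT := h.pos T hT
  have hle : T ≤ T + u T / k := by have : 0 < u T / k := by positivity
                                   linarith
  have h1 := sub_le_mul_of_hasDerivAt_le hle (fun r hr => h.du r (hT.trans_le hr.1)) (C := -k)
    fun r hr => hv r hr.1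
  have h2 : -k * (T + u T / k - T) = -u T := by field_simp; ring
  linarith [h.pos (T + u T / k) (hT.trans_le hle)]

theorem not_w_le (h : Traj σ u v w (Ioi a)) {T k : ℝ} (hT : a < T) (hk : 0 < k)
    (hw : ∀ t, T ≤ t → w t ≤ -k) : False := by
  have hle : T ≤ T + (|v T| + 1) / k := by have : 0 < (|v T| + 1) / k := by positivity
                                           linarith
  refine h.not_v_le (T := T + (|v T| + 1) / k) (hT.trans_le hle) one_pos fun t ht => ?_
  have h1 := sub_le_mul_of_hasDerivAt_le (hle.trans ht) (fun r hr => h.dv r (hT.trans_le hr.1))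
    (C := -k) fun r hr => hw r hr.1
  have h2 : -k * (T + (|v T| + 1) / k - T) = -(|v T| + 1) := by field_simp; ring
  nlinarith [le_abs_self (v T)]

theorem eventually_mul_le (h : Traj σ u v w (Ioi a)) {T k : ℝ} (hT : a < T) (hk : 0 < k)
    (hv : ∀ t, T ≤ t → k ≤ v t) : ∀ᶠ t in atTop, k / 2 * t ≤ u t := by
  filter_upwards [eventually_ge_atTop (2 * |T|)] with t ht
  have htT : T ≤ t := by linarith [le_abs_self T, abs_nonneg T]
  have h1 := mul_le_sub_of_le_hasDerivAt htT (fun r hr => h.du r (hT.trans_le hr.1)) (C := k)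
    fun r hr => hv r hr.1
  nlinarith [h.pos T hT, le_abs_self T]

/-- Linear growth makes `w' = O(t ^ (-3))`, so `w` converges. If its limit is `0`, then `w = O(t ^
(-2))` and `v` converges too. -/
theorem exists_tendsto_w_of_mul_le (h : Traj σ u v w (Ioi a)) {k : ℝ} (hk : 0 < k)
    (hu : ∀ᶠ t in atTop, k * t ≤ u t) :
    (∃ l, Tendsto w atTop (𝓝 l)) ∧ (Tendsto w atTop (𝓝 0) → ∃ K, Tendsto v atTop (𝓝 K)) := by
  obtain ⟨T, hT⟩ := eventually_atTop.1 ((hu.and (eventually_gt_atTop a)).and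
    (eventually_gt_atTop 0))
  have hT0 : 0 ≤ T := (hT T le_rfl).2.le
  have hI : ∀ t, T < t → t ∈ Ioi a := fun t ht => (hT t ht.le).1.2
  have hw' : ∀ t, T < t → |σ / u t ^ 3| ≤ |σ| / k ^ 3 * t ^ (-((2 : ℝ) + 1)) := by
    intro t ht
    have ht0 : 0 < t := hT0.trans_lt ht
    have hut := (hT t ht.le).1.1
    have := h.pos t (hI t ht)
    rw [abs_div, abs_of_pos (pow_pos this 3), Real.rpow_neg ht0.le,
      show (2 : ℝ) + 1 = (3 : ℕ) by norm_num, Real.rpow_natCast, ← div_eq_mul_inv, div_div,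
      ← mul_pow]
    gcongr
  refine ⟨exists_tendsto_atTop_of_abs_deriv_le_rpow hT0 two_pos (by positivity)
    (fun t ht => h.dw t (hI t ht)) hw', fun h0 => ?_⟩
  have hw := abs_le_rpow_of_tendsto_zero hT0 two_pos (by positivity)
    (fun t ht => h.dw t (hI t ht)) hw' h0
  refine exists_tendsto_atTop_of_abs_deriv_le_rpow (C := |σ| / k ^ 3 / 2) hT0 one_pos
    (by positivity) (fun t ht => h.dv t (hI t ht)) fun t ht => ?_
  convert hw t ht using 3
  norm_num

/-- The alternative for the behaviour of a solution at `+∞`. -/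
theorem tendsto_alternative (h : Traj 1 u v w (Ioi a)) :
    (∃ l > 0, Tendsto w atTop (𝓝 l)) ∨
      (Tendsto w atTop (𝓝 0) ∧ ∃ K, 0 ≤ K ∧ Tendsto v atTop (𝓝 K)) := by
  have hmono : ∀ s t, a < s → s ≤ t → w s ≤ w t := fun s t hs hst =>
    h.w_le zero_le_one hst fun r hr => hs.trans_le hr.1
  by_cases hpos : ∃ t₀, a < t₀ ∧ 0 < w t₀
  · left
    obtain ⟨t₀, ht₀, hw₀⟩ := hpos
    -- Since `w ≥ w t₀ > 0` after `t₀`, by this time `v` has reached `1`. Then `u` grows at least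
    -- linearly and `w` converges.
    have hge : t₀ ≤ t₀ + (|v t₀| + 1) / w t₀ := by
      have : 0 < (|v t₀| + 1) / w t₀ := by positivity
      linarith
    obtain ⟨l, hl⟩ := (h.exists_tendsto_w_of_mul_le (half_pos one_pos) (h.eventually_mul_le
      (T := t₀ + (|v t₀| + 1) / w t₀) (ht₀.trans_le hge) one_pos fun t ht => by
        have h1 := mul_le_sub_of_le_hasDerivAt (hge.trans ht)
          (fun r hr => h.dv r (ht₀.trans_le hr.1)) (C := w t₀)
          fun r hr => hmono t₀ r ht₀ hr.1
        have h2 : w t₀ * (t₀ + (|v t₀| + 1) / w t₀ - t₀) = |v t₀| + 1 := by field_simp; ring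
        nlinarith [neg_abs_le (v t₀)])).1
    exact ⟨l, hw₀.trans_le (ge_of_tendsto hl ((eventually_ge_atTop t₀).mono fun t ht =>
      hmono t₀ t ht₀ ht)), hl⟩
  · right
    push Not at hpos
    obtain ⟨l, hl⟩ := exists_tendsto_atTop_of_le hmono hpos
    have hwl : ∀ t, a < t → w t ≤ l := fun t ht =>
      ge_of_tendsto hl ((eventually_ge_atTop t).mono fun s hs => hmono t s ht hs)
    -- A negative limit would drive `v`, and then `u`, below zero.
    have hl0 : l = 0 := by
      refine le_antisymm (le_of_tendsto hl ((eventually_gt_atTop a).mono hpos)) ?_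
      by_contra! hneg
      exact h.not_w_le (T := a + 1) (by linarith) (neg_pos.2 hneg) fun t ht => by
        simpa using hwl t (by linarith)
    have hv_anti : ∀ s t, a < s → s ≤ t → v t ≤ v s := fun s t hs hst => by
      have := sub_le_mul_of_hasDerivAt_le hst (fun r hr => h.dv r (hs.trans_le hr.1)) (C := 0)
        fun r hr => hpos r (hs.trans_le hr.1)
      linarith
    have hv0 : ∀ t, a < t → 0 ≤ v t := by
      intro t ht
      by_contra! hneg
      exact h.not_v_le ht (neg_pos.2 hneg) fun s hs => by simpa using hv_anti t s ht hs
    obtain ⟨K, hK⟩ := exists_tendsto_atTop_of_ge hv_anti hv0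
    exact ⟨hl0 ▸ hl, K, ge_of_tendsto hK ((eventually_gt_atTop a).mono hv0), hK⟩

/-- The alternative for the behaviour at `+∞` of a solution of the reflected equation. -/
theorem tendsto_alternative_neg (h : Traj (-1) u v w (Ioi a)) :
    (∃ l > 0, Tendsto w atTop (𝓝 l)) ∨
      (Tendsto w atTop (𝓝 0) ∧ ∃ K > 0, Tendsto v atTop (𝓝 K)) := by
  have hanti : ∀ s t, a < s → s ≤ t → w t ≤ w s := fun s t hs hst =>
    h.le_w (by norm_num) hst fun r hr => hs.trans_le hr.1
  have hw0 : ∀ t, a < t → 0 ≤ w t := by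
    intro t ht
    by_contra! hneg
    exact h.not_w_le ht (neg_pos.2 hneg) fun s hs => by simpa using hanti t s ht hs
  obtain ⟨l, hl⟩ := exists_tendsto_atTop_of_ge hanti hw0
  rcases (ge_of_tendsto hl ((eventually_gt_atTop a).mono hw0)).eq_or_lt with rfl | hl0
  swap
  · exact Or.inl ⟨l, hl0, hl⟩
  right
  have hv_mono : ∀ s t, a < s → s ≤ t → v s ≤ v t := fun s t hs hst => by
    have := mul_le_sub_of_le_hasDerivAt hst (fun r hr => h.dv r (hs.trans_le hr.1)) (C := 0)
      fun r hr => hw0 r (hs.trans_le hr.1)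
    linarith
  -- If `v ≤ 0` throughout, then `u ≤ u T` and `w' ≤ -1 / u T ^ 3`, so `w ≤ -1` at time `T + (w T +
  -- 1) * u T ^ 3`, contradicting `w ≥ 0`. This excludes slope `0` for the reflected equation.
  obtain ⟨t₀, ht₀, hv₀⟩ : ∃ t₀, a < t₀ ∧ 0 < v t₀ := by
    by_contra! hneg
    set T := a + 1 with hT
    have haT : a < T := by linarith
    have hTu := h.pos T haT
    have hu : ∀ t, T ≤ t → u t ≤ u T := fun t ht => by
      have := sub_le_mul_of_hasDerivAt_le ht (fun r hr => h.du r (haT.trans_le hr.1)) (C := 0)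
        fun r hr => hneg r (haT.trans_le hr.1)
      linarith
    have hle : T ≤ T + (w T + 1) * u T ^ 3 := by
      have := hw0 T haT
      have : 0 ≤ (w T + 1) * u T ^ 3 := by positivity
      linarith
    have h1 := sub_le_mul_of_hasDerivAt_le hle (fun r hr => h.dw r (haT.trans_le hr.1))
      (C := -1 / u T ^ 3) fun r hr => by
        rw [neg_div, neg_div, neg_le_neg_iff]
        have := h.pos r (haT.trans_le hr.1)
        have := hu r hr.1
        gcongr
    have h2 : -1 / u T ^ 3 * (T + (w T + 1) * u T ^ 3 - T) = -(w T + 1) := by field_simp; ring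
    linarith [hw0 _ (haT.trans_le hle)]
  obtain ⟨K, hK⟩ := (h.exists_tendsto_w_of_mul_le (half_pos hv₀) (h.eventually_mul_le ht₀ hv₀
    fun t ht => hv_mono t₀ t ht₀ ht)).2 hl
  exact ⟨hl, K, hv₀.trans_le (ge_of_tendsto hK ((eventually_ge_atTop t₀).mono fun t ht =>
    hv_mono t₀ t ht₀ ht)), hK⟩

theorem tendsto_div_of_tendsto_v (h : Traj σ u v w (Ioi a)) {K : ℝ}
    (hv : Tendsto v atTop (𝓝 K)) : Tendsto (fun t => u t / t) atTop (𝓝 K) := by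
  simpa using tendsto_div_pow_of_hasDerivAt (n := 0)
    ((eventually_gt_atTop a).mono fun t ht => h.du t ht) (by simpa using hv)

theorem tendsto_div_sq_of_tendsto_w (h : Traj σ u v w (Ioi a)) {l : ℝ}
    (hw : Tendsto w atTop (𝓝 l)) : Tendsto (fun t => u t / t ^ 2) atTop (𝓝 (l / 2)) := by
  have hv := tendsto_div_pow_of_hasDerivAt (n := 0)
    ((eventually_gt_atTop a).mono fun t ht => h.dv t ht) (by simpa using hw)
  have := tendsto_div_pow_of_hasDerivAt (n := 1)
    ((eventually_gt_atTop a).mono fun t ht => h.du t ht) (by simpa using hv)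
  norm_num at this
  exact this

/-- The growth of `u` alone selects the branch of the alternative, since `l > 0` would give `u / t ^
2` a nonzero limit. No assumption on derivatives is then needed in the uniqueness statements. -/
theorem tendsto_of_tendsto_div (hσ : σ = 1 ∨ σ = -1) (h : Traj σ u v w (Ioi a)) {K : ℝ}
    (hu : Tendsto (fun t => u t / t) atTop (𝓝 K)) :
    Tendsto w atTop (𝓝 0) ∧ Tendsto v atTop (𝓝 K) := by
  have halt : (∃ l > 0, Tendsto w atTop (𝓝 l)) ∨
      (Tendsto w atTop (𝓝 0) ∧ ∃ K, Tendsto v atTop (𝓝 K)) := by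
    rcases hσ with rfl | rfl
    · exact h.tendsto_alternative.imp_right fun ⟨h2, K, _, h3⟩ => ⟨h2, K, h3⟩
    · exact h.tendsto_alternative_neg.imp_right fun ⟨h2, K, _, h3⟩ => ⟨h2, K, h3⟩
  rcases halt with ⟨l, hl0, hl⟩ | ⟨hw, K', hK'⟩
  · have h1 := h.tendsto_div_sq_of_tendsto_w hl
    have h2 : Tendsto (fun t => u t / t ^ 2) atTop (𝓝 0) :=
      (hu.div_atTop tendsto_id).congr fun t => by simp only [id]; rw [div_div, pow_two]
    have := tendsto_nhds_unique h1 h2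
    linarith
  · rw [tendsto_nhds_unique hu (h.tendsto_div_of_tendsto_v hK')]
    exact ⟨hw, hK'⟩

end Traj

theorem isEquivalent_mul_pow_iff {u : ℝ → ℝ} {c : ℝ} {l : Filter ℝ} (n : ℕ) (hc : c ≠ 0)
    (hl : ∀ᶠ t in l, t ≠ 0) :
    (u ~[l] fun t => c * t ^ n) ↔ Tendsto (fun t => u t / t ^ n) l (𝓝 c) := by
  rw [isEquivalent_iff_tendsto_one (hl.mono fun t ht => mul_ne_zero hc (pow_ne_zero n ht))]
  have e : ∀ t, (u / fun t => c * t ^ n) t = u t / t ^ n / c := fun t => by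
    rw [Pi.div_apply, div_div, mul_comm]
  constructor
  · intro h
    have := h.mul_const c
    rw [one_mul] at this
    exact this.congr fun t => by rw [e, div_mul_cancel₀ _ hc]
  · intro h
    have := h.div_const c
    rw [div_self hc] at this
    exact this.congr fun t => (e t).symm

theorem abs_inv_cube_sub_le {x y m : ℝ} (hm : 0 < m) (hx : m ≤ x) (hy : m ≤ y) :
    |1 / x ^ 3 - 1 / y ^ 3| ≤ 3 / m ^ 4 * |x - y| := by
  have hx0 := hm.trans_le hx
  have hy0 := hm.trans_le hy
  have e : 1 / x ^ 3 - 1 / y ^ 3 =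
      -((1 / (x * y ^ 3) + 1 / (x ^ 2 * y ^ 2) + 1 / (x ^ 3 * y)) * (x - y)) := by
    field_simp
    ring
  rw [e, abs_neg, abs_mul, abs_of_pos (by positivity : 0 < 1 / (x * y ^ 3) + 1 / (x ^ 2 * y ^ 2) +
    1 / (x ^ 3 * y))]
  refine mul_le_mul_of_nonneg_right ?_ (abs_nonneg _)
  have h1 : 1 / (x * y ^ 3) ≤ 1 / (m * m ^ 3) := by gcongr
  have h2 : 1 / (x ^ 2 * y ^ 2) ≤ 1 / (m ^ 2 * m ^ 2) := by gcongr
  have h3 : 1 / (x ^ 3 * y) ≤ 1 / (m ^ 3 * m) := by gcongr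
  have h4 : 3 / m ^ 4 = 1 / (m * m ^ 3) + 1 / (m ^ 2 * m ^ 2) + 1 / (m ^ 3 * m) := by
    field_simp
    norm_num
  linarith

/-! ### Solutions of linear growth: expansion and uniqueness. -/

namespace Traj

variable {σ a K : ℝ} {u v w : ℝ → ℝ}

theorem eventually_half_mul_le (hK : 0 < K) (h : Traj σ u v w (Ioi a))
    (hv : Tendsto v atTop (𝓝 K)) : ∀ᶠ t in atTop, K / 2 * t ≤ u t := by
  filter_upwards [(h.tendsto_div_of_tendsto_v hv).eventually_const_lt (half_lt_self hK),
    eventually_gt_atTop 0] with t ht ht0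
  rw [lt_div_iff₀ ht0] at ht
  exact ht.le

/-- The expansion at `+∞` of a solution with linear growth. -/
theorem exists_tendsto_sub_log (hK : 0 < K) (h : Traj σ u v w (Ioi a))
    (hv : Tendsto v atTop (𝓝 K)) (hw : Tendsto w atTop (𝓝 0)) :
    ∃ A, Tendsto (fun t => u t - K * t - σ * Real.log t / (2 * K ^ 3)) atTop (𝓝 A) := by
  obtain ⟨T, hT⟩ := eventually_atTop.1 (((h.eventually_half_mul_le hK hv).and
    (eventually_gt_atTop a)).and (eventually_ge_atTop 1))
  have hT1 : 1 ≤ T := (hT T le_rfl).2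
  have hT0 : 0 ≤ T := zero_le_one.trans hT1
  have hpos : ∀ t, T ≤ t → 0 < t := fun t ht => by linarith
  have hI : ∀ t, T ≤ t → t ∈ Ioi a := fun t ht => (hT t ht).1.2
  have hlow : ∀ t, T ≤ t → K / 2 * t ≤ u t := fun t ht => (hT t ht).1.1
  set C := |σ| / (K / 2) ^ 3 with hC
  have hC0 : 0 ≤ C := by positivity
  have b3 : ∀ t, T < t → |σ / u t ^ 3| ≤ C * t ^ (-((2 : ℝ) + 1)) := by
    intro t ht
    have ht0 := hpos t ht.le
    have hut := hlow t ht.le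
    have := h.pos t (hI t ht.le)
    rw [abs_div, abs_of_pos (pow_pos this 3), Real.rpow_neg ht0.le,
      show (2 : ℝ) + 1 = (3 : ℕ) by norm_num, Real.rpow_natCast, ← div_eq_mul_inv, hC, div_div,
      ← mul_pow]
    gcongr
  have b2 : ∀ t, T < t → |w t| ≤ C / 2 * t ^ (-((1 : ℝ) + 1)) := by
    convert abs_le_rpow_of_tendsto_zero hT0 two_pos hC0 (fun t ht => h.dw t (hI t ht.le)) b3 hw
      using 6
    norm_num
  have b1 : ∀ t, T < t → |v t - K| ≤ C / 2 * t ^ (-(1 : ℝ)) := by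
    convert abs_le_rpow_of_tendsto_zero (f := fun t => v t - K) hT0 one_pos (by positivity)
      (fun t ht => (h.dv t (hI t ht.le)).sub_const K) b2 (by simpa using hv.sub_const K) using 4
    norm_num
  have hsqrt : ∀ t, 0 < t → HasDerivAt (fun x : ℝ => C * x ^ (1 / 2 : ℝ))
      (C / 2 * t ^ (-(1 / 2) : ℝ)) t := fun t ht => by
    refine ((Real.hasDerivAt_rpow_const (p := 1 / 2) (Or.inl ht.ne')).const_mul C).congr_deriv ?_
    norm_num
    ring
  -- The true size is logarithmic. The cruder `t ^ (1 / 2)` suffices and keeps all bounds powers of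
  -- `t`.
  have b0 : ∃ D, 0 ≤ D ∧ ∀ t, T < t → |u t - K * t| ≤ D * t ^ (1 / 2 : ℝ) := by
    set S := T + 1 with hS
    set f : ℝ → ℝ := fun t => u t - K * t with hf
    have hfd : ∀ t, T ≤ t → HasDerivAt f (v t - K) t := fun t ht =>
      ((h.du t (hI t ht)).sub ((hasDerivAt_id t).const_mul K)).congr_deriv (by simp)
    have b1' : ∀ t, T < t → |v t - K| ≤ C / 2 * t ^ (-(1 / 2) : ℝ) := fun t ht =>
      (b1 t ht).trans (mul_le_mul_of_nonneg_left
        (Real.rpow_le_rpow_of_exponent_le (by linarith) (by norm_num)) (by positivity))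
    obtain ⟨B, hB⟩ := (isCompact_Icc (a := T) (b := S)).exists_bound_of_continuousOn
      (f := f) fun t ht => (hfd t ht.1).continuousAt.continuousWithinAt
    have hB0 : 0 ≤ B := (norm_nonneg _).trans (hB T ⟨le_rfl, by linarith⟩)
    refine ⟨B + C, by positivity, fun t ht => ?_⟩
    have hr1 : 1 ≤ t ^ (1 / 2 : ℝ) := Real.one_le_rpow (by linarith) (by norm_num)
    have hBr : B ≤ B * t ^ (1 / 2 : ℝ) := le_mul_of_one_le_right hB0 hr1
    rcases le_total t S with htS | htS
    · have := hB t ⟨ht.le, htS⟩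
      rw [Real.norm_eq_abs] at this
      have : 0 ≤ C * t ^ (1 / 2 : ℝ) := by positivity
      linarith
    · have hTr : ∀ r ∈ Icc S t, T < r := fun r hr => by linarith [hr.1]
      have u1 := sub_le_sub_of_hasDerivAt_le htS (fun r hr => hfd r (hTr r hr).le)
        (fun r hr => hsqrt r (hpos r (hTr r hr).le))
        fun r hr => (abs_le.1 (b1' r (hTr r hr))).2
      have u2 := sub_le_sub_of_hasDerivAt_le htS (fun r hr => (hfd r (hTr r hr).le).neg)
        (fun r hr => hsqrt r (hpos r (hTr r hr).le))
        fun r hr => by linarith [(abs_le.1 (b1' r (hTr r hr))).1]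
      simp only [Pi.neg_apply] at u2
      have hS0 : 0 ≤ C * S ^ (1 / 2 : ℝ) := by positivity
      have := abs_le.1 (hB S ⟨by linarith, le_rfl⟩)
      exact abs_le.2 ⟨by linarith, by linarith⟩
  obtain ⟨D, hD0, b0⟩ := b0
  set k := σ / (2 * K ^ 3) with hk
  set C' := |σ| * (3 / (K / 2) ^ 4) * D with hC'
  have hC'0 : 0 ≤ C' := by positivity
  have d2 : ∀ t, T < t → HasDerivAt (fun t => w t + k / t ^ 2) (σ / u t ^ 3 - σ / (K * t) ^ 3) t := by
    intro t ht
    have ht0 := (hpos t ht.le).ne'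
    refine ((h.dw t (hI t ht.le)).add (((hasDerivAt_pow 2 t).fun_inv (pow_ne_zero 2 ht0)).const_mul
      k)).congr_deriv ?_
    rw [hk]
    field_simp
    ring
  have d1 : ∀ t, T < t → HasDerivAt (fun t => v t - K - k / t) (w t + k / t ^ 2) t := by
    intro t ht
    have ht0 := (hpos t ht.le).ne'
    refine (((h.dv t (hI t ht.le)).sub_const K).sub ((hasDerivAt_inv ht0).const_mul
      k)).congr_deriv ?_
    field_simp
    ring
  have d0 : ∀ t, T < t → HasDerivAt (fun t => u t - K * t - σ * Real.log t / (2 * K ^ 3))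
      (v t - K - k / t) t := by
    intro t ht
    have ht0 := (hpos t ht.le).ne'
    refine (((h.du t (hI t ht.le)).sub ((hasDerivAt_id t).const_mul K)).sub
      (((Real.hasDerivAt_log ht0).const_mul σ).div_const (2 * K ^ 3))).congr_deriv ?_
    rw [hk]
    field_simp
  -- Replacing `u` by `K t` in `w'` costs `t ^ (1 / 2) / t ^ 4 = t ^ (-7 / 2)`. Two integrations
  -- from infinity leave `t ^ (-3 / 2)` for the derivative of the remainder, which is integrable, so
  -- the remainder converges.
  have c3 : ∀ t, T < t → |σ / u t ^ 3 - σ / (K * t) ^ 3| ≤ C' * t ^ (-((5 / 2 : ℝ) + 1)) := by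
    intro t ht
    have ht0 := hpos t ht.le
    have e1 : σ / u t ^ 3 - σ / (K * t) ^ 3 = σ * (1 / u t ^ 3 - 1 / (K * t) ^ 3) := by ring
    have e2 : t ^ (-((5 / 2 : ℝ) + 1)) = t ^ (1 / 2 : ℝ) / t ^ 4 := by
      rw [← Real.rpow_natCast t 4, ← Real.rpow_sub ht0]
      norm_num
    rw [e1, abs_mul, e2]
    have h1 := abs_inv_cube_sub_le (x := u t) (y := K * t) (m := K / 2 * t) (by positivity)
      (hlow t ht.le) (by nlinarith)
    calc |σ| * |1 / u t ^ 3 - 1 / (K * t) ^ 3|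
        ≤ |σ| * (3 / (K / 2 * t) ^ 4 * (D * t ^ (1 / 2 : ℝ))) := by
          gcongr
          exact h1.trans (by gcongr; exact b0 t ht)
      _ = C' * (t ^ (1 / 2 : ℝ) / t ^ 4) := by
          rw [hC']; field_simp
  have l2 : Tendsto (fun t => w t + k / t ^ 2) atTop (𝓝 0) := by
    simpa using hw.add (tendsto_const_nhds (x := k) |>.div_atTop (tendsto_pow_atTop two_ne_zero))
  have l1 : Tendsto (fun t => v t - K - k / t) atTop (𝓝 0) := by
    simpa using (hv.sub_const K).sub (tendsto_const_nhds (x := k) |>.div_atTop tendsto_id)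
  have c2 : ∀ t, T < t → |w t + k / t ^ 2| ≤ C' / (5 / 2) * t ^ (-((3 / 2 : ℝ) + 1)) := by
    convert abs_le_rpow_of_tendsto_zero hT0 (by norm_num) hC'0 d2 c3 l2 using 6
    norm_num
  have c1 : ∀ t, T < t → |v t - K - k / t| ≤ C' / (5 / 2) / (3 / 2) * t ^ (-((1 / 2 : ℝ) + 1)) := by
    convert abs_le_rpow_of_tendsto_zero hT0 (by norm_num) (by positivity) d1 c2 l1 using 6
    norm_num
  exact exists_tendsto_atTop_of_abs_deriv_le_rpow hT0 (by norm_num) (by positivity) d0 c1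

/-- Two solutions with the same linear growth whose difference tends to `0` coincide. -/
theorem eventuallyEq_of_tendsto_sub {a' : ℝ} {u' v' w' : ℝ → ℝ} (hK : 0 < K)
    (h : Traj σ u v w (Ioi a)) (h' : Traj σ u' v' w' (Ioi a'))
    (hv : Tendsto v atTop (𝓝 K)) (hw : Tendsto w atTop (𝓝 0))
    (hv' : Tendsto v' atTop (𝓝 K)) (hw' : Tendsto w' atTop (𝓝 0))
    (hu : Tendsto (fun t => u t - u' t) atTop (𝓝 0)) : u =ᶠ[atTop] u' := by
  set C := |σ| * (3 / (K / 2) ^ 4) with hC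
  have hC0 : 0 ≤ C := by positivity
  have hu1 : ∀ᶠ t in atTop, |u t - u' t| ≤ 1 :=
    (hu.abs.eventually_lt_const (by simp : |(0 : ℝ)| < 1)).mono fun t ht => ht.le
  obtain ⟨T, hT⟩ := eventually_atTop.1 ((((h.eventually_half_mul_le hK hv).and
    (h'.eventually_half_mul_le hK hv')).and ((eventually_gt_atTop a).and
    (eventually_gt_atTop a'))).and ((eventually_ge_atTop (C + 1)).and hu1))
  have hT0 : 0 < T := by linarith [(hT T le_rfl).2.1]
  have hpos : ∀ t, T < t → 0 < t := fun t ht => hT0.trans ht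
  have hI : ∀ t, T < t → t ∈ Ioi a := fun t ht => (hT t ht.le).1.2.1
  have hI' : ∀ t, T < t → t ∈ Ioi a' := fun t ht => (hT t ht.le).1.2.2
  -- A bound `M` on the difference gives `C M t ^ (-4)` for the difference of the `w'`. Three
  -- integrations from infinity turn this into `C M / (6 t) ≤ M / 2`, as `t ≥ C`. Iterating forces
  -- the difference to vanish.
  have step : ∀ M, 0 ≤ M → (∀ t, T < t → |u t - u' t| ≤ M) → ∀ t, T < t → |u t - u' t| ≤ M / 2 := by
    intro M hM hz
    have c3 : ∀ t, T < t → |σ / u t ^ 3 - σ / u' t ^ 3| ≤ C * M * t ^ (-((3 : ℝ) + 1)) := by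
      intro t ht
      have ht0 := hpos t ht
      have e1 : σ / u t ^ 3 - σ / u' t ^ 3 = σ * (1 / u t ^ 3 - 1 / u' t ^ 3) := by ring
      have e2 : t ^ (-((3 : ℝ) + 1)) = 1 / t ^ 4 := by
        rw [Real.rpow_neg ht0.le, ← Real.rpow_natCast t 4]
        norm_num
      rw [e1, abs_mul, e2]
      have h1 := abs_inv_cube_sub_le (m := K / 2 * t) (by positivity)
        (hT t ht.le).1.1.1 (hT t ht.le).1.1.2
      calc |σ| * |1 / u t ^ 3 - 1 / u' t ^ 3|
          ≤ |σ| * (3 / (K / 2 * t) ^ 4 * M) := by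
            gcongr
            exact h1.trans (by gcongr; exact hz t ht)
        _ = C * M * (1 / t ^ 4) := by
            rw [hC]; field_simp
    have c2 : ∀ t, T < t → |w t - w' t| ≤ C * M / 3 * t ^ (-((2 : ℝ) + 1)) := by
      convert abs_le_rpow_of_tendsto_zero (f := fun t => w t - w' t) hT0.le (by norm_num)
        (by positivity) (fun t ht => (h.dw t (hI t ht)).sub (h'.dw t (hI' t ht))) c3
        (by simpa using hw.sub hw') using 6
      norm_num
    have c1 : ∀ t, T < t → |v t - v' t| ≤ C * M / 3 / 2 * t ^ (-((1 : ℝ) + 1)) := by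
      convert abs_le_rpow_of_tendsto_zero (f := fun t => v t - v' t) hT0.le (by norm_num)
        (by positivity) (fun t ht => (h.dv t (hI t ht)).sub (h'.dv t (hI' t ht))) c2
        (by simpa using hv.sub hv') using 6
      norm_num
    intro t ht
    have c0 := abs_le_rpow_of_tendsto_zero (f := fun t => u t - u' t) hT0.le (by norm_num)
        (by positivity) (fun t ht => (h.du t (hI t ht)).sub (h'.du t (hI' t ht))) c1 hu t ht
    have ht0 := hpos t ht
    rw [Real.rpow_neg_one] at c0
    have hCt : C * t⁻¹ ≤ 1 := by
      rw [mul_inv_le_iff₀ ht0]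
      linarith [(hT T le_rfl).2.1]
    calc |u t - u' t| ≤ C * M / 3 / 2 / 1 * t⁻¹ := c0
      _ = M / 6 * (C * t⁻¹) := by ring
      _ ≤ M / 6 * 1 := by gcongr
      _ ≤ M / 2 := by linarith
  have all : ∀ n : ℕ, ∀ t, T < t → |u t - u' t| ≤ (1 / 2) ^ n := by
    intro n
    induction n with
    | zero => exact fun t ht => by simpa using (hT t ht.le).2.2
    | succ n ih =>
      intro t ht
      have := step _ (by positivity) ih t ht
      rw [pow_succ]
      linarith
  filter_upwards [eventually_gt_atTop T] with t ht
  have hlim : Tendsto (fun n : ℕ => (1 / 2 : ℝ) ^ n) atTop (𝓝 0) :=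
    tendsto_pow_atTop_nhds_zero_of_lt_one (by norm_num) (by norm_num)
  have := ge_of_tendsto' hlim fun n => all n t ht
  exact sub_eq_zero.1 (abs_nonpos_iff.1 this)

end Traj

/-! ### Existence of solutions of linear growth by a fixed point argument. -/

open scoped BoundedContinuousFunction

/-- `G` is the tail integral of `H` over `(t, ∞)`, written as `L` minus a proper integral. -/
theorem exists_antideriv_tendsto_zero {H : ℝ → ℝ} {a C p : ℝ} (hH : Continuous H) (ha : 0 ≤ a)
    (hp : 0 < p) (hC : 0 ≤ C) (hb : ∀ t, a < t → |H t| ≤ C * t ^ (-(p + 1))) :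
    ∃ G : ℝ → ℝ, (∀ t, HasDerivAt G (-H t) t) ∧ Tendsto G atTop (𝓝 0) := by
  have hd : ∀ t, HasDerivAt (fun t => ∫ x in a..t, H x) (H t) t := fun t =>
    (hH.integral_hasStrictDerivAt a t).hasDerivAt
  obtain ⟨L, hL⟩ := exists_tendsto_atTop_of_abs_deriv_le_rpow ha hp hC (fun t _ => hd t) hb
  exact ⟨fun t => L - ∫ x in a..t, H x, fun t => (hd t).const_sub L, by simpa using hL.const_sub L⟩

/-- Existence of solutions with linear growth at `+∞`. -/
theorem exists_traj_linear {σ K : ℝ} (hσ : |σ| ≤ 1) (hK : 0 < K) :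
    ∃ a u v w, Traj σ u v w (Ioi a) ∧ Tendsto v atTop (𝓝 K) ∧ Tendsto w atTop (𝓝 0) := by
  -- Here `48 / K ^ 4 = 3 / (K / 2) ^ 4` is the Lipschitz factor of the inverse cube. This choice of
  -- `a` gives contraction factor `1 / 2` and keeps `|q| ≤ K / 2`.
  obtain ⟨a, ha1, haK⟩ : ∃ a : ℝ, 1 ≤ a ∧ 48 / K ^ 4 ≤ a := ⟨max 1 (48 / K ^ 4), le_max_left _ _,
    le_max_right _ _⟩
  have ha0 : 0 ≤ a := by linarith
  -- The unknown is `q = v - K`, which is bounded although `u` is not; `U q` is the corresponding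
  -- `u`.
  set U : (ℝ →ᵇ ℝ) → ℝ → ℝ := fun q t => K * t + ∫ x in a..t, q x with hU
  have dU : ∀ q t, HasDerivAt (U q) (K + q t) t := fun q t =>
    (((hasDerivAt_id t).const_mul K).add
      (q.continuous.integral_hasStrictDerivAt a t).hasDerivAt).congr_deriv (by simp)
  set m : ℝ → ℝ := fun t => K / 2 * max t a with hm
  have hm0 : ∀ t, 0 < m t := fun t => by
    have : 0 < max t a := lt_max_of_lt_right (by linarith)
    positivity
  have hma : ∀ t, a < t → m t = K / 2 * t := fun t ht => by simp only [hm, max_eq_left ht.le]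
  -- Truncating at `m` makes the map defined for every `q`; `hUm` shows that the truncation is
  -- inactive at the fixed point.
  set H : (ℝ →ᵇ ℝ) → ℝ → ℝ := fun q t => 1 / (max (U q t) (m t)) ^ 3 with hH
  have hmax : ∀ q t, 0 < max (U q t) (m t) := fun q t => lt_max_of_lt_right (hm0 t)
  have cH : ∀ q, Continuous (H q) := fun q => by
    have c1 : Continuous (U q) := continuous_iff_continuousAt.2 fun t => (dU q t).continuousAt
    have c2 : Continuous m := by fun_prop
    exact continuous_const.div ((c1.max c2).pow 3) fun t => (pow_pos (hmax q t) 3).ne'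
  have bH : ∀ q t, a < t → |-H q t| ≤ 8 / K ^ 3 * t ^ (-((2 : ℝ) + 1)) := by
    intro q t ht
    have ht0 : 0 < t := ha0.trans_lt ht
    have h1 : K / 2 * t ≤ max (U q t) (m t) := hma t ht ▸ le_max_right _ _
    have h2 : t ^ (-((2 : ℝ) + 1)) = 1 / t ^ 3 := by
      rw [Real.rpow_neg ht0.le, ← Real.rpow_natCast t 3]
      norm_num
    rw [abs_neg, abs_of_pos (one_div_pos.2 (pow_pos (hmax q t) 3)), h2]
    calc 1 / (max (U q t) (m t)) ^ 3 ≤ 1 / (K / 2 * t) ^ 3 := by gcongr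
      _ = 8 / K ^ 3 * (1 / t ^ 3) := by field_simp; norm_num
  have hG1 : ∀ q, ∃ G : ℝ → ℝ, (∀ t, HasDerivAt G (-H q t) t) ∧ Tendsto G atTop (𝓝 0) := fun q =>
    exists_antideriv_tendsto_zero (C := 8 / K ^ 3) (cH q) ha0 two_pos (by positivity)
      fun t ht => abs_neg (H q t) ▸ bH q t ht
  choose G₁ dG₁ lG₁ using hG1
  have bG₁ : ∀ q t, a < t → |-G₁ q t| ≤ 8 / K ^ 3 / 2 * t ^ (-((1 : ℝ) + 1)) := by
    intro q
    simp only [abs_neg]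
    convert abs_le_rpow_of_tendsto_zero ha0 two_pos (by positivity) (fun t _ => dG₁ q t) (bH q)
      (lG₁ q) using 6
    norm_num
  have hG2 : ∀ q, ∃ G : ℝ → ℝ, (∀ t, HasDerivAt G (-G₁ q t) t) ∧ Tendsto G atTop (𝓝 0) := fun q =>
    exists_antideriv_tendsto_zero (C := 8 / K ^ 3 / 2)
      (continuous_iff_continuousAt.2 fun t => (dG₁ q t).continuousAt) ha0 one_pos
      (by positivity) fun t ht => abs_neg (G₁ q t) ▸ bG₁ q t ht
  choose G₂ dG₂ lG₂ using hG2
  have bG₂ : ∀ q t, a < t → |G₂ q t| ≤ 4 / K ^ 3 * t⁻¹ := by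
    intro q
    convert abs_le_rpow_of_tendsto_zero ha0 one_pos (by positivity) (fun t _ => dG₂ q t) (bG₁ q)
      (lG₂ q) using 4
    · ring
    · rw [Real.rpow_neg_one]
  have hmx : ∀ t, a < max t (a + 1) := fun t => (lt_add_one a).trans_le (le_max_right _ _)
  have small : ∀ q t, |σ * G₂ q (max t (a + 1))| ≤ K / 2 := by
    intro q t
    have h1 := bG₂ q _ (hmx t)
    have h2 : (max t (a + 1))⁻¹ ≤ a⁻¹ := inv_anti₀ (by linarith) (hmx t).le
    have h3 : 4 / K ^ 3 * a⁻¹ ≤ K / 2 := by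
      rw [← div_eq_mul_inv, div_le_iff₀ (by linarith), div_le_iff₀ (by positivity)]
      rw [div_le_iff₀ (by positivity)] at haK
      nlinarith
    rw [abs_mul]
    calc |σ| * |G₂ q (max t (a + 1))| ≤ 1 * (4 / K ^ 3 * a⁻¹) := by
          gcongr
          exact h1.trans (by gcongr)
      _ ≤ K / 2 := by rwa [one_mul]
  -- With `G₁`, `G₂` the iterated tail integrals of `H`, the equation reads `q = σ G₂`, with `w = -σ
  -- G₁`. Freezing the argument below `a + 1` makes the image bounded on `ℝ`, so the fixed point
  -- solves the equation only beyond `a + 1`.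
  set Φ : (ℝ →ᵇ ℝ) → (ℝ →ᵇ ℝ) := fun q => BoundedContinuousFunction.ofNormedAddCommGroup
    (fun t => σ * G₂ q (max t (a + 1)))
    (continuous_const.mul ((continuous_iff_continuousAt.2 fun t => (dG₂ q t).continuousAt).comp
      (continuous_id.max continuous_const))) (K / 2) (small q) with hΦ
  have hΦa : ∀ q t, Φ q t = σ * G₂ q (max t (a + 1)) := fun q t => rfl
  have contr : ContractingWith (1 / 2) Φ := by
    refine ⟨by norm_num, LipschitzWith.of_dist_le_mul fun q₁ q₂ => ?_⟩
    set d := dist q₁ q₂ with hd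
    have hd0 : 0 ≤ d := dist_nonneg
    have e3 : ∀ t, a < t → |-H q₁ t - -H q₂ t| ≤ 48 / K ^ 4 * d * t ^ (-((2 : ℝ) + 1)) := by
      intro t ht
      have ht0 : 0 < t := ha0.trans_lt ht
      have h2 : t ^ (-((2 : ℝ) + 1)) = 1 / t ^ 3 := by
        rw [Real.rpow_neg ht0.le, ← Real.rpow_natCast t 3]
        norm_num
      have hUU : |U q₁ t - U q₂ t| ≤ d * t := by
        have hi : ∀ q : ℝ →ᵇ ℝ, IntervalIntegrable q MeasureTheory.volume a t := fun q =>
          q.continuous.intervalIntegrable a t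
        have : U q₁ t - U q₂ t = ∫ x in a..t, (q₁ x - q₂ x) := by
          rw [intervalIntegral.integral_sub (hi q₁) (hi q₂)]
          simp only [hU]; ring
        rw [this, ← Real.norm_eq_abs]
        refine (intervalIntegral.norm_integral_le_of_norm_le_const (C := d) fun x _ => ?_).trans ?_
        · rw [← dist_eq_norm]; exact BoundedContinuousFunction.dist_coe_le_dist x
        · rw [abs_of_pos (by linarith)]
          gcongr
          linarith
      have h1 := abs_inv_cube_sub_le (hm0 t) (le_max_right (U q₁ t) (m t))
        (le_max_right (U q₂ t) (m t))
      rw [neg_sub_neg, abs_sub_comm, h2]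
      calc |H q₁ t - H q₂ t| ≤ 3 / m t ^ 4 * |max (U q₁ t) (m t) - max (U q₂ t) (m t)| := h1
        _ ≤ 3 / (K / 2 * t) ^ 4 * (d * t) := by
            rw [hma t ht]
            gcongr
            exact (abs_max_sub_max_le_abs _ _ _).trans hUU
        _ = 48 / K ^ 4 * d * (1 / t ^ 3) := by field_simp; norm_num; ring
    have e2 : ∀ t, a < t → |-G₁ q₁ t - -G₁ q₂ t| ≤ 48 / K ^ 4 * d / 2 * t ^ (-((1 : ℝ) + 1)) := by
      intro t ht
      rw [neg_sub_neg, abs_sub_comm]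
      convert abs_le_rpow_of_tendsto_zero (f := fun t => G₁ q₁ t - G₁ q₂ t) ha0 two_pos
        (by positivity) (fun t _ => (dG₁ q₁ t).sub (dG₁ q₂ t)) e3
        (by simpa using (lG₁ q₁).sub (lG₁ q₂)) t ht using 3
      norm_num
    have e1 : ∀ t, a < t → |G₂ q₁ t - G₂ q₂ t| ≤ 48 / K ^ 4 * d / 2 * t⁻¹ := by
      intro t ht
      convert abs_le_rpow_of_tendsto_zero (f := fun t => G₂ q₁ t - G₂ q₂ t) ha0 one_pos
        (by positivity) (fun t _ => (dG₂ q₁ t).sub (dG₂ q₂ t)) e2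
        (by simpa using (lG₂ q₁).sub (lG₂ q₂)) t ht using 2
      · ring
      · rw [Real.rpow_neg_one]
    refine (BoundedContinuousFunction.dist_le (by positivity)).2 fun t => ?_
    rw [hΦa, hΦa, Real.dist_eq, ← mul_sub, abs_mul]
    have h1 := e1 _ (hmx t)
    have h2 : (max t (a + 1))⁻¹ ≤ a⁻¹ := inv_anti₀ (by linarith) (hmx t).le
    calc |σ| * |G₂ q₁ (max t (a + 1)) - G₂ q₂ (max t (a + 1))|
        ≤ 1 * (48 / K ^ 4 * d / 2 * a⁻¹) := by
          gcongr
          exact h1.trans (by gcongr)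
      _ = (48 / K ^ 4 / a) * (d / 2) := by ring
      _ ≤ 1 * (d / 2) := by
          gcongr
          exact (div_le_one (by linarith)).2 haK
      _ = _ := by simp; ring
  obtain ⟨q, hq⟩ : ∃ q, Φ q = q := ⟨_, contr.fixedPoint_isFixedPt⟩
  have hqa : ∀ t, q t = σ * G₂ q (max t (a + 1)) := fun t => by
    conv_lhs => rw [← hq]
    exact hΦa q t
  have hqt : ∀ t, a + 1 < t → q t = σ * G₂ q t := fun t ht => by rw [hqa, max_eq_left ht.le]
  have hqe : ∀ t, a + 1 < t → q =ᶠ[𝓝 t] fun t => σ * G₂ q t := fun t ht => by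
    filter_upwards [Ioi_mem_nhds ht] with s hs using hqt s hs
  have hUm : ∀ t, a < t → m t ≤ U q t := by
    intro t ht
    have h1 : ‖∫ x in a..t, q x‖ ≤ K / 2 * |t - a| :=
      intervalIntegral.norm_integral_le_of_norm_le_const fun x _ => by
        rw [hqa, Real.norm_eq_abs]; exact small q x
    rw [Real.norm_eq_abs, abs_of_pos (by linarith : 0 < t - a)] at h1
    rw [hma t ht]
    simp only [hU]
    nlinarith [neg_abs_le (∫ x in a..t, q x)]
  refine ⟨a + 1, U q, fun t => K + q t, fun t => σ * -G₁ q t, ⟨fun t ht => ?_, fun t _ => dU q t,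
    fun t ht => ?_, fun t ht => ?_⟩, ?_, ?_⟩
  · exact (hm0 t).trans_le (hUm t (by linarith [mem_Ioi.1 ht]))
  · exact (((dG₂ q t).const_mul σ).congr_of_eventuallyEq (hqe t ht)).const_add K
  · refine ((dG₁ q t).neg.const_mul σ).congr_deriv ?_
    simp only [hH, neg_neg, max_eq_left (hUm t (by linarith [mem_Ioi.1 ht]))]
    ring
  · have h1 : Tendsto (fun t => σ * G₂ q t) atTop (𝓝 0) := by simpa using (lG₂ q).const_mul σ
    have h2 : Tendsto q atTop (𝓝 0) := h1.congr' (by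
      filter_upwards [eventually_gt_atTop (a + 1)] with t ht using (hqt t ht).symm)
    simpa using h2.const_add K
  · simpa using ((lG₁ q).neg).const_mul σ

/-! ### Solutions of sublinear growth are determined by their left endpoint. -/

namespace Traj

variable {a : ℝ} {u v w : ℝ → ℝ}

/-- As `w` increases to `0`, the increment of `v` over `[t / 2, t]` is at most `t w t / 2 ≤ 0`, and
that increment tends to `0`. -/
theorem tendsto_mul_w (h : Traj 1 u v w (Ioi a)) (hv : Tendsto v atTop (𝓝 0))
    (hw : Tendsto w atTop (𝓝 0)) : Tendsto (fun t => t * w t) atTop (𝓝 0) := by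
  have hmono : ∀ s t, a < s → s ≤ t → w s ≤ w t := fun s t hs hst =>
    h.w_le zero_le_one hst fun r hr => hs.trans_le hr.1
  have hw0 : ∀ t, a < t → w t ≤ 0 := fun t ht =>
    ge_of_tendsto hw ((eventually_ge_atTop t).mono fun s hs => hmono t s ht hs)
  have h1 : Tendsto (fun t => 2 * (v t - v (t / 2))) atTop (𝓝 0) := by
    simpa using (hv.sub (hv.comp (tendsto_id.atTop_div_const two_pos))).const_mul 2
  refine tendsto_of_tendsto_of_tendsto_of_le_of_le' h1 tendsto_const_nhds ?_ ?_
  · filter_upwards [eventually_gt_atTop (2 * |a|)] with t ht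
    have hat : a < t / 2 := by linarith [le_abs_self a]
    have ht0 : 0 ≤ t := by linarith [abs_nonneg a]
    have := sub_le_mul_of_hasDerivAt_le (by linarith : t / 2 ≤ t)
      (fun r hr => h.dv r (hat.trans_le hr.1)) (C := w t)
      fun r hr => hmono r t (hat.trans_le hr.1) hr.2
    linarith
  · filter_upwards [eventually_gt_atTop 0, eventually_gt_atTop a] with t ht hta
    exact mul_nonpos_of_nonneg_of_nonpos ht.le (hw0 t hta)

/-- Two solutions of sublinear growth at `+∞` which vanish at the same left endpoint coincide. -/
theorem eqOn_of_sublinear {u' v' w' : ℝ → ℝ} (h : Traj 1 u v w (Ioi a))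
    (h' : Traj 1 u' v' w' (Ioi a)) (hv : Tendsto v atTop (𝓝 0)) (hv' : Tendsto v' atTop (𝓝 0))
    (hu : Tendsto u (𝓝[>] a) (𝓝 0)) (hu' : Tendsto u' (𝓝[>] a) (𝓝 0)) : EqOn u u' (Ioi a) := by
  have hw := (h.tendsto_of_tendsto_div (Or.inl rfl) (h.tendsto_div_of_tendsto_v hv)).1
  have hw' := (h'.tendsto_of_tendsto_div (Or.inl rfl) (h'.tendsto_div_of_tendsto_v hv')).1
  set z : ℝ → ℝ := fun t => u t - u' t with hz
  set z₁ : ℝ → ℝ := fun t => v t - v' t with hz₁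
  set z₂ : ℝ → ℝ := fun t => w t - w' t with hz₂
  have dz : ∀ t, a < t → HasDerivAt z (z₁ t) t := fun t ht => (h.du t ht).sub (h'.du t ht)
  have dz₁ : ∀ t, a < t → HasDerivAt z₁ (z₂ t) t := fun t ht => (h.dv t ht).sub (h'.dv t ht)
  have dz₂ : ∀ t, a < t → HasDerivAt z₂ (1 / u t ^ 3 - 1 / u' t ^ 3) t := fun t ht =>
    (h.dw t ht).sub (h'.dw t ht)
  have lz₁ : Tendsto z₁ atTop (𝓝 0) := by simpa using hv.sub hv'
  have hsign : ∀ t, a < t → z t * (1 / u t ^ 3 - 1 / u' t ^ 3) ≤ 0 := by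
    intro t ht
    have p := h.pos t ht
    have p' := h'.pos t ht
    rcases le_total (u t) (u' t) with hle | hle
    · exact mul_nonpos_of_nonpos_of_nonneg (sub_nonpos.2 hle) (sub_nonneg.2 (by gcongr))
    · exact mul_nonpos_of_nonneg_of_nonpos (sub_nonneg.2 hle) (sub_nonpos.2 (by gcongr))
  -- `E' = z z'''` is nonpositive because the inverse cube is decreasing. Since `E → 0`, `E ≥ 0`, so
  -- `z z'' ≥ 0` and `z z'` is nondecreasing.
  set E : ℝ → ℝ := fun t => z t * z₂ t - z₁ t ^ 2 / 2 with hE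
  have dE : ∀ t, a < t → HasDerivAt E (z t * (1 / u t ^ 3 - 1 / u' t ^ 3)) t := fun t ht =>
    (((dz t ht).mul (dz₂ t ht)).sub (((dz₁ t ht).fun_pow 2).div_const 2)).congr_deriv (by
      norm_num; ring)
  have lE : Tendsto E atTop (𝓝 0) := by
    have l1 : Tendsto (fun t => z t / t) atTop (𝓝 0) := by
      have := (h.tendsto_div_of_tendsto_v hv).sub (h'.tendsto_div_of_tendsto_v hv')
      rw [sub_zero] at this
      exact this.congr fun t => by simp only [hz]; ring
    have l2 : Tendsto (fun t => t * z₂ t) atTop (𝓝 0) := by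
      have := (h.tendsto_mul_w hv hw).sub (h'.tendsto_mul_w hv' hw')
      rw [sub_zero] at this
      exact this.congr fun t => by simp only [hz₂]; ring
    have := (l1.mul l2).sub ((lz₁.pow 2).div_const 2)
    norm_num at this
    refine this.congr' ?_
    filter_upwards [eventually_gt_atTop 0] with t ht
    simp only [hE]
    field_simp
  have E0 : ∀ t, a < t → 0 ≤ E t := fun t ht =>
    le_of_tendsto lE ((eventually_ge_atTop t).mono fun s hs => by
      have := sub_le_mul_of_hasDerivAt_le hs (fun r hr => dE r (ht.trans_le hr.1)) (C := 0)
        fun r hr => hsign r (ht.trans_le hr.1)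
      linarith)
  have hzz : ∀ t, a < t → 0 ≤ z t * z₂ t := fun t ht => by
    have := E0 t ht
    simp only [hE] at this
    nlinarith [sq_nonneg (z₁ t)]
  have gmono : ∀ s t, a < s → s ≤ t → z s * z₁ s ≤ z t * z₁ t := by
    intro s t hs hst
    have := mul_le_sub_of_le_hasDerivAt hst
      (fun r hr => (dz r (hs.trans_le hr.1)).fun_mul (dz₁ r (hs.trans_le hr.1))) (C := 0)
      fun r hr => by nlinarith [hzz r (hs.trans_le hr.1), sq_nonneg (z₁ r)]
    linarith
  -- If `z z'` were positive at `t₀`, it would stay positive. Then `z' z''` has the sign of `z z''`,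
  -- so `z' ^ 2` could not decrease, contradicting `z' → 0`. Hence `z ^ 2` is nonincreasing, and it
  -- starts from `0` at `a`.
  have g0 : ∀ t, a < t → z t * z₁ t ≤ 0 := by
    intro t₀ ht₀
    by_contra! hg
    have hz₁0 : 0 < z₁ t₀ ^ 2 := by
      have : z₁ t₀ ≠ 0 := fun h0 => by simp [h0] at hg
      positivity
    have hge : ∀ t, t₀ ≤ t → z₁ t₀ ^ 2 ≤ z₁ t ^ 2 := by
      intro t ht
      have := mul_le_sub_of_le_hasDerivAt ht
        (fun r hr => (dz₁ r (ht₀.trans_le hr.1)).fun_pow 2) (C := 0) fun r hr => by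
          have hgr := hg.trans_le (gmono t₀ r ht₀ hr.1)
          have hzr : 0 < z r ^ 2 := by
            have : z r ≠ 0 := fun h0 => by simp [h0] at hgr
            positivity
          have hprod : 0 ≤ (z₁ r * z₂ r) * z r ^ 2 := by
            have := mul_nonneg hgr.le (hzz r (ht₀.trans_le hr.1))
            nlinarith
          have := nonneg_of_mul_nonneg_left hprod hzr
          norm_num
          linarith
      linarith
    have := ge_of_tendsto (lz₁.pow 2) ((eventually_ge_atTop t₀).mono hge)
    norm_num at this
    exact hz₁0.ne' (by simp [this])
  intro t ht
  have lz : Tendsto (fun s => z s ^ 2) (𝓝[>] a) (𝓝 0) := by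
    have := (hu.sub hu').pow 2
    norm_num at this
    exact this
  have hle : z t ^ 2 ≤ 0 := by
    refine ge_of_tendsto lz ?_
    filter_upwards [Ioo_mem_nhdsGT (show a < t from ht)] with s hs
    have := sub_le_mul_of_hasDerivAt_le hs.2.le
      (fun r hr => (dz r (hs.1.trans_le hr.1)).fun_pow 2) (C := 0) fun r hr => by
        norm_num
        linarith [g0 r (hs.1.trans_le hr.1)]
    linarith
  have : z t = 0 := by nlinarith
  exact sub_eq_zero.1 this

end Traj

/-! ### The explicit solutions. -/

theorem traj_powerSolution (c : ℝ) : ∃ v w, Traj 1 (powerSolution c) v w (Ioi c) ∧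
    Tendsto v atTop (𝓝 0) := by
  set A : ℝ := (64 / 15 : ℝ) ^ (1 / 4 : ℝ) with hA
  have hA0 : 0 < A := by positivity
  -- Three derivatives of `A s ^ (3 / 4)` produce the factor `(3 / 4) (-1 / 4) (-5 / 4) = 15 / 64`,
  -- so the equation requires `15 / 64 * A = A ^ (-3)`.
  have hA4 : A ^ 4 = 64 / 15 := by
    rw [hA, ← Real.rpow_natCast, ← Real.rpow_mul (by norm_num)]
    norm_num
  have d : ∀ (B p t : ℝ), c < t → HasDerivAt (fun t => B * (t - c) ^ p)
      (B * p * (t - c) ^ (p - 1)) t := fun B p t ht =>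
    ((((hasDerivAt_id t).sub_const c).rpow_const (p := p)
      (Or.inl (sub_pos.2 ht).ne')).const_mul B).congr_deriv (by simp only [id]; ring)
  refine ⟨fun t => A * (3 / 4) * (t - c) ^ ((3 / 4 : ℝ) - 1),
    fun t => A * (3 / 4) * ((3 / 4 : ℝ) - 1) * (t - c) ^ ((3 / 4 : ℝ) - 1 - 1),
    ⟨fun t ht => ?_, fun t ht => d _ _ t ht, fun t ht => d _ _ t ht, fun t ht => ?_⟩, ?_⟩
  · have : 0 < t - c := sub_pos.2 ht
    unfold powerSolution
    positivity
  · have htc : 0 < t - c := sub_pos.2 ht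
    refine (d _ _ t ht).congr_deriv ?_
    unfold powerSolution
    have e : (t - c) ^ ((3 / 4 : ℝ) - 1 - 1 - 1) = 1 / ((t - c) ^ (3 / 4 : ℝ)) ^ 3 := by
      rw [← Real.rpow_natCast, ← Real.rpow_mul htc.le, one_div, ← Real.rpow_neg htc.le]
      norm_num
    have : 0 < (t - c) ^ (3 / 4 : ℝ) := by positivity
    rw [e, ← hA, mul_pow]
    field_simp
    linear_combination 15 * hA4
  · have h1 : Tendsto (fun t : ℝ => (t - c) ^ (-(1 / 4) : ℝ)) atTop (𝓝 0) :=
      (tendsto_rpow_neg_atTop (by norm_num)).comp (tendsto_atTop_add_const_right atTop (-c) tendsto_id)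
    have := h1.const_mul (A * (3 / 4))
    rw [mul_zero] at this
    refine this.congr fun t => ?_
    norm_num

theorem tendsto_powerSolution (c : ℝ) : Tendsto (powerSolution c) (𝓝[>] c) (𝓝 0) := by
  have : ContinuousAt (powerSolution c) c := by
    unfold powerSolution
    exact continuousAt_const.mul ((continuousAt_id.sub continuousAt_const).rpow_const
      (Or.inr (by norm_num)))
  have h := this.tendsto.mono_left (nhdsWithin_le_nhds (s := Ioi c))
  simpa [powerSolution] using h

/-- An extension to the left would be continuous and positive at `c`, contradicting the limit `0`.
-/
theorem isMaximalSolution_Ioi_of_tendsto_zero {φ : ℝ → ℝ} {c : ℝ} (h : IsSolutionOn φ (Ioi c))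
    (h0 : Tendsto φ (𝓝[>] c) (𝓝 0)) : IsMaximalSolution φ (Ioi c) := by
  refine ⟨h, fun ψ J hψ hJ he => Subset.antisymm (fun t ht => ?_) hJ⟩
  by_contra htc
  have hcJ : c ∈ J := hψ.ordConnected.out ht (hJ (lt_add_one c)) ⟨not_lt.1 htc, by linarith⟩
  have h1 : Tendsto ψ (𝓝[>] c) (𝓝 (ψ c)) :=
    (hψ.traj.du c hcJ).continuousAt.tendsto.mono_left nhdsWithin_le_nhds
  have h2 : Tendsto ψ (𝓝[>] c) (𝓝 0) := h0.congr' (by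
    filter_upwards [self_mem_nhdsWithin] with s hs using (he hs).symm)
  exact (hψ.pos c hcJ).ne' (tendsto_nhds_unique h1 h2)

theorem isMaximalSolution_powerSolution (c : ℝ) : IsMaximalSolution (powerSolution c) (Ioi c) := by
  obtain ⟨v, w, h, -⟩ := traj_powerSolution c
  exact isMaximalSolution_Ioi_of_tendsto_zero
    (h.isSolutionOn isOpen_Ioi ordConnected_Ioi nonempty_Ioi) (tendsto_powerSolution c)

/-! ### Solutions with linear growth, normalized by their expansion -/

theorem tendsto_div_of_tendsto_sub_log {σ K A : ℝ} {u : ℝ → ℝ}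
    (h : Tendsto (fun t => u t - K * t - σ * Real.log t / (2 * K ^ 3)) atTop (𝓝 A)) :
    Tendsto (fun t => u t / t) atTop (𝓝 K) := by
  have h1 : Tendsto (fun t : ℝ => Real.log t / t) atTop (𝓝 0) :=
    Real.isLittleO_log_id_atTop.tendsto_div_nhds_zero
  have h2 := ((h.div_atTop tendsto_id).add (h1.const_mul (σ / (2 * K ^ 3)))).add_const K
  rw [mul_zero, add_zero, zero_add] at h2
  refine h2.congr' ?_
  filter_upwards [eventually_gt_atTop 0] with t ht
  simp only [id]
  field_simp
  ring

theorem tendsto_log_add_sub_log (c : ℝ) :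
    Tendsto (fun t : ℝ => Real.log (t + c) - Real.log t) atTop (𝓝 0) := by
  have h1 : Tendsto (fun t : ℝ => 1 + c / t) atTop (𝓝 1) := by
    simpa using (tendsto_const_nhds (x := c).div_atTop tendsto_id).const_add (1 : ℝ)
  have h2 := (Real.continuousAt_log one_ne_zero).tendsto.comp h1
  rw [Real.log_one] at h2
  refine h2.congr' ?_
  filter_upwards [eventually_gt_atTop 0, eventually_gt_atTop (-c)] with t ht htc
  have : t + c ≠ 0 := by linarith
  rw [Function.comp_apply, ← Real.log_div this ht.ne']
  congr 1
  field_simp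

/-- Since `log (t + c) - log t → 0`, a translation affects only the constant term. As `K ≠ 0`, every
constant can be normalized to `0`. -/
theorem tendsto_sub_log_comp_add {σ K A : ℝ} {u : ℝ → ℝ} (c : ℝ)
    (h : Tendsto (fun t => u t - K * t - σ * Real.log t / (2 * K ^ 3)) atTop (𝓝 A)) :
    Tendsto (fun t => u (t + c) - K * t - σ * Real.log t / (2 * K ^ 3)) atTop
      (𝓝 (A + K * c)) := by
  have h1 := (h.comp (tendsto_atTop_add_const_right atTop c tendsto_id)).add_const (K * c)
  have h2 := h1.add ((tendsto_log_add_sub_log c).const_mul (σ / (2 * K ^ 3)))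
  rw [mul_zero, add_zero] at h2
  refine h2.congr fun t => ?_
  simp only [Function.comp_apply, id]
  ring

namespace Traj

variable {σ a K : ℝ} {u v w : ℝ → ℝ}

theorem exists_normalized (hσ : |σ| ≤ 1) (hK : 0 < K) :
    ∃ a u v w, Traj σ u v w (Ioi a) ∧
      Tendsto (fun t => u t - K * t - σ * Real.log t / (2 * K ^ 3)) atTop (𝓝 0) := by
  obtain ⟨a, u, v, w, h, hv, hw⟩ := exists_traj_linear hσ hK
  obtain ⟨A, hA⟩ := h.exists_tendsto_sub_log hK hv hw
  have hset : {t | t + -A / K ∈ Ioi a} = Ioi (a - -A / K) := by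
    ext t
    exact (sub_lt_iff_lt_add (a := a) (b := t) (c := -A / K)).symm
  refine ⟨a - -A / K, _, _, _, hset ▸ h.comp_add_const (-A / K), ?_⟩
  have := tendsto_sub_log_comp_add (-A / K) hA
  rwa [mul_div_cancel₀ _ hK.ne', add_neg_cancel] at this

theorem eventuallyEq_of_normalized {a' A : ℝ} {u' v' w' : ℝ → ℝ} (hσ : σ = 1 ∨ σ = -1)
    (hK : 0 < K) (h : Traj σ u v w (Ioi a)) (h' : Traj σ u' v' w' (Ioi a'))
    (hu : Tendsto (fun t => u t - K * t - σ * Real.log t / (2 * K ^ 3)) atTop (𝓝 A))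
    (hu' : Tendsto (fun t => u' t - K * t - σ * Real.log t / (2 * K ^ 3)) atTop (𝓝 A)) :
    u =ᶠ[atTop] u' := by
  obtain ⟨hw, hv⟩ := h.tendsto_of_tendsto_div hσ (tendsto_div_of_tendsto_sub_log hu)
  obtain ⟨hw', hv'⟩ := h'.tendsto_of_tendsto_div hσ (tendsto_div_of_tendsto_sub_log hu')
  refine h.eventuallyEq_of_tendsto_sub hK h' hv hw hv' hw' ?_
  have := hu.sub hu'
  rw [sub_self] at this
  exact this.congr fun t => by ring

/-- A solution defined on the whole line does not become concave at `+∞`. -/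
theorem not_tendsto_w_zero (h : Traj 1 u v w univ) : ¬ Tendsto w atTop (𝓝 0) := by
  intro hw
  have hmono : ∀ s t, s ≤ t → w s ≤ w t := fun s t hst =>
    h.w_le zero_le_one hst (subset_univ _)
  have hw0 : ∀ t, w t ≤ 0 := fun t =>
    ge_of_tendsto hw ((eventually_ge_atTop t).mono fun s hs => hmono t s hs)
  have h' : Traj (-1) _ _ _ (Ioi 0) := h.comp_neg.mono fun t _ => mem_univ (-t)
  -- Either branch of the reflected alternative gives `w` a nonnegative limit at `-∞`. As `w`
  -- increases to `0`, it vanishes identically, whereas `w' = 1 / u ^ 3 > 0`.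
  have hlim : ∃ l, 0 ≤ l ∧ Tendsto (fun t => w (-t)) atTop (𝓝 l) := by
    rcases h'.tendsto_alternative_neg with ⟨l, hl, hl'⟩ | ⟨h0, -⟩
    · exact ⟨l, hl.le, hl'⟩
    · exact ⟨0, le_rfl, h0⟩
  obtain ⟨l, hl0, hl⟩ := hlim
  have hw1 : ∀ t, w t = 0 := fun t => le_antisymm (hw0 t) <|
    hl0.trans (le_of_tendsto hl ((eventually_ge_atTop (-t)).mono fun s hs =>
      hmono _ _ (by linarith)))
  have hd := h.dw 0 (mem_univ 0)
  rw [show w = fun _ => 0 from funext hw1] at hd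
  have := hd.unique (hasDerivAt_const 0 0)
  have hp := h.pos 0 (mem_univ 0)
  exact (one_div_pos.2 (pow_pos hp 3)).ne' this

end Traj

/-! ### Identification of solutions with translates of a maximal one. -/

theorem IsSolutionOn.exists_Ioi_subset {φ : ℝ → ℝ} {I : Set ℝ} (h : IsSolutionOn φ I)
    (hI : ¬ BddAbove I) : ∃ a, Ioi a ⊆ I := by
  obtain ⟨a, ha⟩ := h.nonempty
  refine ⟨a, fun t ht => ?_⟩
  obtain ⟨y, hy, hty⟩ := not_bddAbove_iff.1 hI t
  exact h.ordConnected.out ha hy ⟨(mem_Ioi.1 ht).le, hty.le⟩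

theorem IsSolutionOn.exists_Ioi_subset_neg {φ : ℝ → ℝ} {I : Set ℝ} (h : IsSolutionOn φ I)
    (hI : ¬ BddBelow I) : ∃ a, Ioi a ⊆ -I := by
  obtain ⟨a, ha⟩ := h.nonempty
  refine ⟨-a, fun t ht => ?_⟩
  obtain ⟨y, hy, hty⟩ := not_bddBelow_iff.1 hI (-t)
  exact h.ordConnected.out hy ha ⟨hty.le, by linarith [mem_Ioi.1 ht]⟩

theorem IsSolutionOn.comp_add_const {φ : ℝ → ℝ} {I : Set ℝ} (h : IsSolutionOn φ I) (c : ℝ) :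
    IsSolutionOn (fun t => φ (t + c)) {t | t + c ∈ I} := by
  refine (h.traj.comp_add_const c).isSolutionOn (h.isOpen.preimage (by fun_prop)) ⟨?_⟩ ?_
  · intro x hx y hy z hz
    exact h.ordConnected.out hx hy ⟨by linarith [hz.1], by linarith [hz.2]⟩
  · obtain ⟨x, hx⟩ := h.nonempty
    exact ⟨x - c, by simpa using hx⟩

theorem IsMaximalSolution.eq_comp_add {φ ψ : ℝ → ℝ} {I J : Set ℝ} {c t : ℝ}
    (hφ : IsMaximalSolution φ J) (hψ : IsSolutionOn ψ I) (htI : t ∈ I) (htJ : t + c ∈ J)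
    (h : ψ =ᶠ[𝓝 t] fun s => φ (s + c)) : ∀ s ∈ I, s + c ∈ J ∧ ψ s = φ (s + c) := by
  have hmem : t + c ∈ {s | s + -c ∈ I} := by simpa using htI
  have he : φ =ᶠ[𝓝 (t + c)] fun s => ψ (s + -c) := by
    have hc : Tendsto (fun s => s + -c) (𝓝 (t + c)) (𝓝 t) := by
      have : Continuous fun s : ℝ => s + -c := by fun_prop
      simpa using this.tendsto (t + c)
    filter_upwards [hc.eventually h] with s hs
    rw [hs, neg_add_cancel_right]
  obtain ⟨h1, h2⟩ := hφ.subset_and_eqOn (hψ.comp_add_const (-c)) htJ hmem he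
  intro s hs
  have hs' : s + c ∈ {s | s + -c ∈ I} := by simpa using hs
  exact ⟨h1 hs', by simpa using h2 hs'⟩

theorem IsMaximalSolution.eq_comp_add_of_normalized_atTop {φ ψ : ℝ → ℝ} {I J : Set ℝ} {K c : ℝ}
    (hK : 0 < K) (hφ : IsMaximalSolution φ J) (hψ : IsSolutionOn ψ I) (hI : ¬ BddAbove I)
    (h : Tendsto (fun t => φ t - K * t - Real.log t / (2 * K ^ 3)) atTop (𝓝 0))
    (h' : Tendsto (fun t => ψ t - K * t - Real.log t / (2 * K ^ 3)) atTop (𝓝 (K * c))) :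
    ∀ s ∈ I, s + c ∈ J ∧ ψ s = φ (s + c) := by
  obtain ⟨a, ha⟩ := hφ.isSolutionOn.exists_Ioi_subset hφ.not_bddAbove
  obtain ⟨b, hb⟩ := hψ.exists_Ioi_subset hI
  have h1 := (hφ.isSolutionOn.traj.comp_add_const c).mono (J := Ioi (a - c)) fun t ht =>
    ha (mem_Ioi.2 (sub_lt_iff_lt_add.1 ht))
  have h2 := tendsto_sub_log_comp_add (σ := 1) c (by simpa using h)
  rw [zero_add] at h2
  have he := (hψ.traj.mono hb).eventuallyEq_of_normalized (Or.inl rfl) hK h1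
    (by simpa using h') h2
  obtain ⟨T, hT⟩ := eventually_atTop.1 (he.and ((eventually_gt_atTop (a - c)).and
    (eventually_gt_atTop b)))
  refine hφ.eq_comp_add hψ (t := T + 1) (hb (hT _ (by linarith)).2.2)
    (ha (mem_Ioi.2 (sub_lt_iff_lt_add.1 (hT _ (by linarith)).2.1))) ?_
  filter_upwards [Ioi_mem_nhds (lt_add_one T)] with s hs using (hT s (mem_Ioi.1 hs).le).1

theorem tendsto_atBot_iff_comp_neg {f : ℝ → ℝ} {l : Filter ℝ} :
    Tendsto f atBot l ↔ Tendsto (fun t => f (-t)) atTop l :=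
  ⟨fun h => h.comp tendsto_neg_atTop_atBot,
    fun h => (h.comp tendsto_neg_atBot_atTop).congr fun t => by simp⟩

theorem tendsto_add_log_atBot_iff {φ : ℝ → ℝ} {K A : ℝ} :
    Tendsto (fun t => φ t + K * t + Real.log (-t) / (2 * K ^ 3)) atBot (𝓝 A) ↔
      Tendsto (fun t => φ (-t) - K * t - -1 * Real.log t / (2 * K ^ 3)) atTop (𝓝 A) := by
  rw [tendsto_atBot_iff_comp_neg]
  refine tendsto_congr fun t => ?_
  rw [neg_neg]
  ring

theorem IsMaximalSolution.eq_comp_add_of_normalized_atBot {φ ψ : ℝ → ℝ} {I : Set ℝ} {K c : ℝ}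
    (hK : 0 < K) (hφ : IsMaximalSolution φ univ) (hψ : IsSolutionOn ψ I) (hI : ¬ BddBelow I)
    (h : Tendsto (fun t => φ t + K * t + Real.log (-t) / (2 * K ^ 3)) atBot (𝓝 0))
    (h' : Tendsto (fun t => ψ t + K * t + Real.log (-t) / (2 * K ^ 3)) atBot (𝓝 (-(K * c)))) :
    ∀ s ∈ I, ψ s = φ (s + c) := by
  rw [tendsto_add_log_atBot_iff] at h h'
  obtain ⟨b, hb⟩ := hψ.exists_Ioi_subset_neg hI
  have h1 := (hφ.isSolutionOn.traj.comp_neg.comp_add_const (-c)).mono (J := Ioi 0) fun t _ =>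
    mem_univ (-(t + -c))
  have h2 := tendsto_sub_log_comp_add (-c) h
  rw [zero_add, mul_neg] at h2
  have he := (hψ.traj.comp_neg.mono hb).eventuallyEq_of_normalized (Or.inr rfl) hK h1 h' h2
  obtain ⟨T, hT⟩ := eventually_atTop.1 (he.and (eventually_gt_atTop b))
  refine fun s hs => (hφ.eq_comp_add hψ (t := -(T + 1)) (hb (hT _ (by linarith)).2)
    (mem_univ _) ?_ s hs).2
  filter_upwards [Iio_mem_nhds (show -(T + 1) < -T by linarith)] with s hs
  have : ψ (- -s) = φ (-(-s + -c)) := (hT (-s) (by linarith [mem_Iio.1 hs])).1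
  rw [neg_neg] at this
  rw [this]
  congr 1
  ring

/-! ### Growth conditions in terms of limits -/

theorem linearAtTop_iff {φ : ℝ → ℝ} {K : ℝ} (hK : 0 < K) :
    (φ ~[atTop] fun ζ => K * ζ) ↔ Tendsto (fun t => φ t / t) atTop (𝓝 K) := by
  simpa using isEquivalent_mul_pow_iff (u := φ) 1 hK.ne' (eventually_ne_atTop (0 : ℝ))

theorem linearAtBot_iff {φ : ℝ → ℝ} {K : ℝ} (hK : 0 < K) :
    (φ ~[atBot] fun ζ => -K * ζ) ↔ Tendsto (fun t => φ (-t) / t) atTop (𝓝 K) := by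
  have h := isEquivalent_mul_pow_iff (u := φ) 1 (neg_ne_zero.2 hK.ne')
    (eventually_ne_atBot (0 : ℝ))
  simp only [pow_one] at h
  rw [h, tendsto_atBot_iff_comp_neg, ← tendsto_neg_iff]
  refine tendsto_congr' (Eventually.of_forall fun t => ?_) |>.trans (by rw [neg_neg])
  rw [div_neg, neg_neg]

theorem Traj.parabolicAtTop {φ v w : ℝ → ℝ} {I : Set ℝ} {a l : ℝ} (hI : ¬ BddAbove I)
    (h : Traj 1 φ v w (Ioi a)) (hl : 0 < l) (hw : Tendsto w atTop (𝓝 l)) : ParabolicAtTop φ I :=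
  ⟨hI, l / 2, half_pos hl, (isEquivalent_mul_pow_iff 2 (half_pos hl).ne'
    (eventually_ne_atTop (0 : ℝ))).2 (h.tendsto_div_sq_of_tendsto_w hw)⟩

/-! ### Assembly of the classification. -/

theorem exists_linearAtBot_solution {K : ℝ} (hK : 0 < K) : ∃ φ : ℝ → ℝ,
    IsMaximalSolution φ univ ∧ LinearAtBot φ univ K ∧
    Tendsto (fun ζ => φ ζ + K * ζ + Real.log (-ζ) / (2 * K ^ 3)) atBot (𝓝 0) ∧
    ParabolicAtTop φ univ := by
  obtain ⟨a, u, v, w, h, hu⟩ := Traj.exists_normalized (σ := -1) (by norm_num) hK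
  have h' := h.comp_neg
  rw [neg_neg, neg_Ioi] at h'
  have hs := h'.isSolutionOn isOpen_Iio ordConnected_Iio nonempty_Iio
  obtain ⟨φ, J, hφ, hJ, he⟩ := hs.exists_maximal
  -- The reflected solution lives near `-∞`, and maximal solutions always reach `+∞`.
  obtain rfl := hφ.eq_univ fun hb => not_bddBelow_Iio (-a) (hb.mono hJ)
  have heu : ∀ᶠ t in atTop, φ (-t) = u t := by
    filter_upwards [eventually_gt_atTop a] with t ht
    simpa using he (x := -t) (by simpa using ht)
  have hn : Tendsto (fun t => φ (-t) - K * t - -1 * Real.log t / (2 * K ^ 3)) atTop (𝓝 0) :=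
    hu.congr' (heu.mono fun t ht => by simp only [ht])
  refine ⟨φ, hφ, ⟨not_bddBelow_univ, (linearAtBot_iff hK).2 (tendsto_div_of_tendsto_sub_log hn)⟩,
    tendsto_add_log_atBot_iff.2 hn, ?_⟩
  have hT := hφ.isSolutionOn.traj
  have hT0 := hT.mono (subset_univ (Ioi 0))
  rcases hT0.tendsto_alternative with ⟨l, hl, hw⟩ | ⟨hw, -⟩
  · exact hT0.parabolicAtTop not_bddAbove_univ hl hw
  · exact absurd hw hT.not_tendsto_w_zero

theorem exists_linearAtTop_solution {K : ℝ} (hK : 0 < K) : ∃ (φ : ℝ → ℝ) (ζs : ℝ),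
    IsMaximalSolution φ (Ioi ζs) ∧ LinearAtTop φ (Ioi ζs) K ∧
    Tendsto (fun ζ => φ ζ - K * ζ - Real.log ζ / (2 * K ^ 3)) atTop (𝓝 0) ∧
    Tendsto φ (𝓝[>] ζs) (𝓝 0) := by
  obtain ⟨a, u, v, w, h, hu⟩ := Traj.exists_normalized (σ := 1) (by norm_num) hK
  have hs := h.isSolutionOn isOpen_Ioi ordConnected_Ioi nonempty_Ioi
  obtain ⟨φ, J, hφ, hJ, he⟩ := hs.exists_maximal
  have hn : Tendsto (fun t => φ t - K * t - 1 * Real.log t / (2 * K ^ 3)) atTop (𝓝 0) := by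
    refine hu.congr' ?_
    filter_upwards [eventually_gt_atTop a] with t ht
    rw [he ht]
  have hdiv := tendsto_div_of_tendsto_sub_log hn
  -- Linear growth makes `w → 0` at `+∞`, which no solution on the whole line allows.
  have hb : BddBelow J := by
    by_contra hb
    obtain rfl := hφ.eq_univ hb
    have hT := hφ.isSolutionOn.traj
    exact hT.not_tendsto_w_zero ((hT.mono (subset_univ (Ioi 0))).tendsto_of_tendsto_div
      (Or.inl rfl) hdiv).1
  obtain ⟨ζs, rfl, h0⟩ := hφ.eq_Ioi hb
  exact ⟨φ, ζs, hφ, ⟨not_bddAbove_Ioi ζs, (linearAtTop_iff hK).2 hdiv⟩, by simpa using hn, h0⟩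

/-- The behaviour at `+∞` and at the left end of the remaining maximal solutions. -/
theorem IsMaximalSolution.parabolic_of_not_linear {φ : ℝ → ℝ} {I : Set ℝ}
    (h : IsMaximalSolution φ I) (hbot : ¬ ∃ K : ℝ, 0 < K ∧ LinearAtBot φ I K)
    (htop : ¬ ∃ K : ℝ, 0 < K ∧ LinearAtTop φ I K)
    (hpow : ¬ ∃ c : ℝ, I = Ioi c ∧ EqOn φ (powerSolution c) I) :
    ParabolicAtTop φ I ∧
      ((∃ ζs : ℝ, I = Ioi ζs ∧ Tendsto φ (𝓝[>] ζs) (𝓝 0)) ∨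
        (I = univ ∧ ParabolicAtBot φ I)) := by
  have hT := h.isSolutionOn.traj
  constructor
  · obtain ⟨a, ha⟩ := h.isSolutionOn.exists_Ioi_subset h.not_bddAbove
    have hTa := hT.mono ha
    rcases hTa.tendsto_alternative with ⟨l, hl, hw⟩ | ⟨hw, K, hK, hv⟩
    · exact hTa.parabolicAtTop h.not_bddAbove hl hw
    exfalso
    -- Slope `0` with a finite left endpoint gives the power solution with that endpoint, and slope
    -- `0` on the whole line is impossible. Positive slope is the excluded linear case.
    rcases hK.eq_or_lt with rfl | hK
    · by_cases hb : BddBelow I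
      · obtain ⟨c, rfl, h0⟩ := h.eq_Ioi hb
        obtain ⟨v, w, hP, hPv⟩ := traj_powerSolution c
        exact hpow ⟨c, rfl, hT.eqOn_of_sublinear hP hv hPv h0 (tendsto_powerSolution c)⟩
      · obtain rfl := h.eq_univ hb
        exact hT.not_tendsto_w_zero hw
    · exact htop ⟨K, hK, h.not_bddAbove,
        (linearAtTop_iff hK).2 (hTa.tendsto_div_of_tendsto_v hv)⟩
  · by_cases hb : BddBelow I
    · exact Or.inl (h.eq_Ioi hb)
    right
    obtain rfl := h.eq_univ hb
    refine ⟨rfl, ?_⟩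
    have hT' : Traj (-1) _ _ _ (Ioi 0) := hT.comp_neg.mono fun t _ => mem_univ (-t)
    rcases hT'.tendsto_alternative_neg with ⟨l, hl, hw⟩ | ⟨-, K, hK, hv⟩
    · refine ⟨hb, l / 2, half_pos hl, (isEquivalent_mul_pow_iff 2 (half_pos hl).ne'
        (eventually_ne_atBot (0 : ℝ))).2 (tendsto_atBot_iff_comp_neg.2 ?_)⟩
      simpa using hT'.tendsto_div_sq_of_tendsto_w hw
    · exact absurd ⟨K, hK, hb, (linearAtBot_iff hK).2 (hT'.tendsto_div_of_tendsto_v hv)⟩ hbot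

theorem theoremA2p1 :
    -- solutions that are linear as `ζ → -∞`
    (∀ K : ℝ, 0 < K → ∃ φ : ℝ → ℝ,
      IsMaximalSolution φ univ ∧
      LinearAtBot φ univ K ∧
      Tendsto (fun ζ => φ ζ + K * ζ + Real.log (-ζ) / (2 * K ^ 3)) atBot (𝓝 0) ∧
      ParabolicAtTop φ univ ∧
      (∀ (ψ : ℝ → ℝ) (I : Set ℝ), IsSolutionOn ψ I → LinearAtBot ψ I K →
        ∃ c : ℝ, ∀ ζ ∈ I, ψ ζ = φ (ζ + c)) ∧
      (∀ (ψ : ℝ → ℝ) (I : Set ℝ), IsSolutionOn ψ I → ¬ BddBelow I →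
        Tendsto (fun ζ => ψ ζ + K * ζ + Real.log (-ζ) / (2 * K ^ 3)) atBot (𝓝 0) →
        EqOn ψ φ I)) ∧
    -- solutions that are linear as `ζ → +∞`
    (∀ K : ℝ, 0 < K → ∃ (φ : ℝ → ℝ) (ζs : ℝ),
      IsMaximalSolution φ (Ioi ζs) ∧
      LinearAtTop φ (Ioi ζs) K ∧
      Tendsto (fun ζ => φ ζ - K * ζ - Real.log ζ / (2 * K ^ 3)) atTop (𝓝 0) ∧
      Tendsto φ (𝓝[>] ζs) (𝓝 0) ∧
      (∀ (ψ : ℝ → ℝ) (I : Set ℝ), IsSolutionOn ψ I → LinearAtTop ψ I K →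
        ∃ c : ℝ, ∀ ζ ∈ I, ζs < ζ + c ∧ ψ ζ = φ (ζ + c)) ∧
      (∀ (ψ : ℝ → ℝ) (I : Set ℝ), IsSolutionOn ψ I → ¬ BddAbove I →
        Tendsto (fun ζ => ψ ζ - K * ζ - Real.log ζ / (2 * K ^ 3)) atTop (𝓝 0) →
        I ⊆ Ioi ζs ∧ EqOn ψ φ I)) ∧
    -- the explicit solutions
    (∀ c : ℝ, IsMaximalSolution (powerSolution c) (Ioi c)) ∧
    -- all other solutions
    (∀ (φ : ℝ → ℝ) (I : Set ℝ), IsMaximalSolution φ I →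
      (¬ ∃ K : ℝ, 0 < K ∧ LinearAtBot φ I K) →
      (¬ ∃ K : ℝ, 0 < K ∧ LinearAtTop φ I K) →
      (¬ ∃ c : ℝ, I = Ioi c ∧ EqOn φ (powerSolution c) I) →
      ParabolicAtTop φ I ∧
      ((∃ ζs : ℝ, I = Ioi ζs ∧ Tendsto φ (𝓝[>] ζs) (𝓝 0)) ∨
        (I = univ ∧ ParabolicAtBot φ I))) := by
  refine ⟨fun K hK => ?_, fun K hK => ?_, isMaximalSolution_powerSolution,
    fun φ I h h1 h2 h3 => h.parabolic_of_not_linear h1 h2 h3⟩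
  · obtain ⟨φ, hφ, hlin, hn, hpar⟩ := exists_linearAtBot_solution hK
    refine ⟨φ, hφ, hlin, hn, hpar, fun ψ I hψ hlinψ => ?_, fun ψ I hψ hI hnψ s hs => ?_⟩
    · obtain ⟨b, hb⟩ := hψ.exists_Ioi_subset_neg hlinψ.1
      have hT := hψ.traj.comp_neg.mono hb
      obtain ⟨hw, hv⟩ := hT.tendsto_of_tendsto_div (Or.inr rfl) ((linearAtBot_iff hK).1 hlinψ.2)
      obtain ⟨A, hA⟩ := hT.exists_tendsto_sub_log hK hv hw
      -- Replacing `ζ` by `ζ + c` changes the constant at `-∞` by `-K c`, so matching `A` requires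
      -- `c = -A / K`; at `+∞` the sign is opposite.
      refine ⟨-A / K, hφ.eq_comp_add_of_normalized_atBot hK hψ hlinψ.1 hn ?_⟩
      rw [mul_div_cancel₀ _ hK.ne', neg_neg]
      exact tendsto_add_log_atBot_iff.2 hA
    · simpa using hφ.eq_comp_add_of_normalized_atBot (c := 0) hK hψ hI hn (by simpa using hnψ) s hs
  · obtain ⟨φ, ζs, hφ, hlin, hn, h0⟩ := exists_linearAtTop_solution hK
    refine ⟨φ, ζs, hφ, hlin, hn, h0, fun ψ I hψ hlinψ => ?_, fun ψ I hψ hI hnψ => ?_⟩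
    · obtain ⟨b, hb⟩ := hψ.exists_Ioi_subset hlinψ.1
      have hT := hψ.traj.mono hb
      obtain ⟨hw, hv⟩ := hT.tendsto_of_tendsto_div (Or.inl rfl) ((linearAtTop_iff hK).1 hlinψ.2)
      obtain ⟨A, hA⟩ := hT.exists_tendsto_sub_log hK hv hw
      refine ⟨A / K, hφ.eq_comp_add_of_normalized_atTop hK hψ hlinψ.1 hn ?_⟩
      rw [mul_div_cancel₀ _ hK.ne']
      simpa using hA
    · have := hφ.eq_comp_add_of_normalized_atTop (c := 0) hK hψ hI hn (by simpa using hnψ)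
      simp only [add_zero] at this
      exact ⟨fun s hs => (this s hs).1, fun s hs => (this s hs).2⟩
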